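/- Let $p$ be a prime, let $k$ be an algebraically closed field of characteristic $p$, let $K_0=\mathrm{Frac}(W(k))$ be the fraction field of the ring of Witt vectors of $k$, and fix an algebraic closure of $K_0$. For $n\ge 1$ let $K_n=K_0(\zeta_{p^n})$, where $\zeta_{p^n}$ is a primitive $p^n$-th root of unity, and let $v_n$ be the valuation on $K_n$ normalized so that uniformizers have valuation $1$ (and $v_n(0)=\infty$). For a finite Galois extension $L/K_0$ with group $G$ and normalized valuation $v_L$, let $G_i$ ($i\in\mathbb{R}_{\ge 0}$) be the higher ramification groups in the lower numbering, $G_i=\{g\in G: v_L(gx-x)\ge i+1 \text{ for all } x \text{ in the ring of integers of } L\}$. Let $\phi(u)=\int_0^u \frac{dt}{[G_0:G_t]}$ for $u\ge 0$, let $\psi:[0,\infty)\to[0,\infty)$ be the inverse of $\phi$, and let $G^i=G_{\psi(i)}$ be the higher ramification groups in the upper numbering. The conductor of $L/K_0$ is $h_{L/K_0}=\sup\{i\in[0,\infty): G^i\ne\{\mathrm{id}\}\}$ (with $h_{L/K_0}=0$ if $L=K_0$). Let $\ell\ge 1$, $c\ge 1$ and $d\ge\max(\ell,c)$ be integers. Let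 $\alpha\in K_\ell$ with $v_\ell(\alpha)\ge 0$, and write $\alpha=1+t_\alpha$. Let $\sqrt[p^c]{\alpha}$ be any $p^c$-th root of $\alpha$ in the algebraic closure, and let $L$ be the Galois closure of $K_d(\sqrt[p^c]{\alpha})$ over $K_0$. Then $$h_{L/K_0}\le\max\left(d-1,\ c+\ell-1-\frac{v_\ell(t_\alpha)-1}{p^{\ell-1}(p-1)},\ c+\ell-2+\frac{1}{p^{\ell-1}(p-1)}\right),$$ where the second term is read as $-\infty$, i.e. omitted, if $t_\alpha=0$. -/

import Mathlib

namespace LocalRamification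

open IsLocalRing

section DiscreteValuationRings

theorem adicComplete_of_finite (A B : Type*) [CommRing A] [IsNoetherianRing A] [IsLocalRing A]
    [IsAdicComplete (maximalIdeal A) A] [CommRing B] [Algebra A B] [Module.Finite A B] :
    IsAdicComplete ((maximalIdeal A).map (algebraMap A B)) B := by
  rw [IsAdicComplete.map_algebraMap_iff]
  have h1 := AdicCompletion.ofTensorProduct_surjective_of_finite (maximalIdeal A) B
  have h2 : Function.Bijective (AdicCompletion.of (maximalIdeal A) A) :=
    AdicCompletion.of_bijective_iff.2 ‹_›
  let e := LinearEquiv.ofBijective (AdicCompletion.of (maximalIdeal A) A) h2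
  let f : B ≃ₗ[A] TensorProduct A (AdicCompletion (maximalIdeal A) A) B :=
    (TensorProduct.lid A B).symm ≪≫ₗ TensorProduct.congr e (LinearEquiv.refl A B)
  have h3 : ⇑(AdicCompletion.of (maximalIdeal A) B) =
      AdicCompletion.ofTensorProduct (maximalIdeal A) B ∘ f := by
    ext x n
    simp only [f, e, Function.comp_apply, LinearEquiv.trans_apply, TensorProduct.lid_symm_apply,
      TensorProduct.congr_tmul, LinearEquiv.ofBijective_apply, LinearEquiv.refl_apply,
      AdicCompletion.ofTensorProduct_tmul]
    simp
    exact (one_smul A _).symm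
  have : IsPrecomplete (maximalIdeal A) B := by
    rw [← AdicCompletion.of_surjective_iff, h3]
    exact h1.comp f.surjective
  exact ⟨⟩

theorem isLocalRing_of_finite_of_isAdicComplete (A B : Type*) [CommRing A] [IsDomain A]
    [IsDiscreteValuationRing A] [IsAdicComplete (maximalIdeal A) A] [CommRing B]
    [IsDedekindDomain B] [Algebra A B] [Module.Finite A B] [FaithfulSMul A B] :
    IsLocalRing B := by
  have hc := adicComplete_of_finite A B
  set J := (maximalIdeal A).map (algebraMap A B) with hJ
  have hens : HenselianRing B J := inferInstance
  have hJ0 : J ≠ ⊥ := by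
    rw [hJ, Ne, Ideal.map_eq_bot_iff_of_injective (FaithfulSMul.algebraMap_injective A B)]
    exact IsDiscreteValuationRing.not_a_field A
  have hle : ∀ P : Ideal B, P.IsMaximal → J ≤ P := fun P hP =>
    hens.jac.trans (sInf_le ⟨bot_le, hP⟩)
  refine IsLocalRing.of_unique_max_ideal ?_
  obtain ⟨P, hP⟩ := Ideal.exists_maximal B
  refine ⟨P, hP, fun Q hQ => ?_⟩
  by_contra hne
  have hP0 : P ≠ ⊥ := fun h => hJ0 (le_bot_iff.1 (h ▸ hle P hP))
  have hfin : FiniteMultiplicity P J :=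
    FiniteMultiplicity.of_prime_left (Ideal.prime_of_isPrime hP0 hP.isPrime) hJ0
  obtain ⟨C, hJC, hC⟩ := hfin.exists_eq_pow_mul_and_not_dvd
  set n := multiplicity P J
  have hn : n ≠ 0 := by
    intro h
    rw [h, pow_zero, one_mul] at hJC
    exact hC (hJC ▸ Ideal.dvd_iff_le.2 (hle P hP))
  have hCQ : C ≤ Q := by
    have h := hle Q hQ
    rw [hJC, hQ.isPrime.mul_le] at h
    refine h.resolve_left fun h => hne ?_
    exact (hP.eq_of_le hQ.ne_top (hQ.isPrime.le_of_pow_le h)).symm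
  have hcop : IsCoprime (P ^ n) C := by
    refine IsCoprime.pow_left (Ideal.isCoprime_iff_sup_eq.2 ?_)
    by_contra h
    exact hC (Ideal.dvd_iff_le.2
      (le_sup_right.trans (hP.eq_of_le h le_sup_left).symm.le))
  obtain ⟨e, he, e', he', hee⟩ := Ideal.isCoprime_iff_exists.1 hcop
  have hm : e * e' ∈ J := hJC ▸ Ideal.mul_mem_mul he he'
  have heq : e' = 1 - e := by rw [← hee]; ring
  obtain ⟨a, ha, haJ⟩ := hens.is_henselian (Polynomial.X ^ 2 - Polynomial.X)
    (by monicity!) e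
    (by simpa [heq, pow_two, mul_sub] using J.neg_mem hm) (by
      refine IsUnit.of_mul_eq_one (Ideal.Quotient.mk J (2 * e - 1)) ?_
      rw [← map_mul, ← map_one (Ideal.Quotient.mk J), Ideal.Quotient.eq]
      convert J.mul_mem_left (-4) hm using 1
      simp [heq]
      ring)
  have heP : e ∈ P := Ideal.pow_le_self hn he
  have ha' : a = 0 ∨ a = 1 := by
    have : a * (a - 1) = 0 := by
      have := ha.eq_zero
      simp at this
      linear_combination this
    rcases mul_eq_zero.1 this with h | h
    · exact Or.inl h
    · exact Or.inr (sub_eq_zero.1 h)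
  rcases ha' with rfl | rfl
  · have h1 : e ∈ Q := by simpa using Q.neg_mem (hle Q hQ haJ)
    exact hQ.ne_top (Q.eq_top_iff_one.2 (hee ▸ Q.add_mem h1 (hCQ he')))
  · have h1 := P.add_mem (hle P hP haJ) heP
    exact hP.ne_top (P.eq_top_iff_one.2 (by simpa using h1))


theorem isDiscreteValuationRing_integralClosure (A K L : Type*) [CommRing A] [IsDomain A]
    [IsDiscreteValuationRing A] [IsAdicComplete (maximalIdeal A) A] [Field K] [Algebra A K]
    [IsFractionRing A K] [Field L] [Algebra K L] [Algebra A L] [IsScalarTower A K L]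
    [FiniteDimensional K L] [Algebra.IsSeparable K L] :
    IsDiscreteValuationRing (integralClosure A L) := by
  have := integralClosure.isDedekindDomain A K L
  have := IsIntegralClosure.finite A K L (integralClosure A L)
  have hinj : Function.Injective (algebraMap A L) := by
    rw [IsScalarTower.algebraMap_eq A K L]
    exact (algebraMap K L).injective.comp (IsFractionRing.injective A K)
  have : FaithfulSMul A (integralClosure A L) := by
    rw [faithfulSMul_iff_algebraMap_injective]
    intro x y hxy
    exact hinj (congrArg Subtype.val hxy)
  have := isLocalRing_of_finite_of_isAdicComplete A (integralClosure A L)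
  have hnf : ¬ IsField (integralClosure A L) := fun h =>
    IsDiscreteValuationRing.not_isField A
      (isField_of_isIntegral_of_isField (FaithfulSMul.algebraMap_injective A (integralClosure A L)) h)
  exact ((IsDiscreteValuationRing.TFAE (integralClosure A L) hnf).out 2 0).1 ‹IsDedekindDomain _›

end DiscreteValuationRings

section Ramification

/-! Here `K` is the fraction field of a complete discrete valuation ring `A`, and `L` is a finite
separable extension of `K`, with ring of integers `integralClosure A L`. -/

variable (A K L : Type*) [CommRing A] [IsDomain A] [IsDiscreteValuationRing A]
  [IsAdicComplete (maximalIdeal A) A] [Field K] [Algebra A K] [IsFractionRing A K]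
  [Field L] [Algebra K L] [Algebra A L] [IsScalarTower A K L]
  [FiniteDimensional K L] [Algebra.IsSeparable K L]

/-- The normalized valuation of `L` (uniformizers have valuation `1`, and `0` has valuation `⊤`),
on the ring of integers of `L`. -/
noncomputable def val : AddValuation (integralClosure A L) ℕ∞ :=
  haveI := isDiscreteValuationRing_integralClosure A K L
  IsDiscreteValuationRing.addVal (integralClosure A L)

/-- The ramification group `G_i` in the lower numbering, for real `i ≥ 0`: all `g ∈ Gal(L/K)` with
`v_L(g x - x) ≥ i + 1` for every integer `x` of `L`. -/
noncomputable def lowerGroup (i : ℝ) : Subgroup Gal(L/K) where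
  carrier := {g | ∀ x : integralClosure A L, ((⌈i⌉₊ + 1 : ℕ) : ℕ∞) ≤ val A K L (g • x - x)}
  one_mem' x := by simp
  mul_mem' {g h} hg hh x := by
    have : (g * h) • x - x = (g • (h • x) - h • x) + (h • x - x) := by
      rw [mul_smul]; abel
    rw [this]
    exact (le_min (hg _) (hh _)).trans (AddValuation.map_add _ _ _)
  inv_mem' {g} hg x := by
    have : g⁻¹ • x - x = -(g • (g⁻¹ • x) - g⁻¹ • x) := by
      rw [smul_inv_smul]; abel
    rw [this, AddValuation.map_neg]
    exact hg _

/-- The Herbrand function `φ(u) = ∫₀ᵘ dt / [G_0 : G_t]`. -/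
noncomputable def herbrandPhi (u : ℝ) : ℝ :=
  ∫ t in (0 : ℝ)..u, (((lowerGroup A K L t).relIndex (lowerGroup A K L 0) : ℕ) : ℝ)⁻¹

/-- The inverse `ψ : [0, ∞) → [0, ∞)` of the Herbrand function `φ`. -/
noncomputable def herbrandPsi : ℝ → ℝ :=
  Function.invFunOn (herbrandPhi A K L) (Set.Ici 0)

/-- The ramification group `G^i = G_{ψ(i)}` in the upper numbering, for real `i ≥ 0`. -/
noncomputable def upperGroup (i : ℝ) : Subgroup Gal(L/K) :=
  lowerGroup A K L (herbrandPsi A K L i)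

/-- The conductor `h_{L/K}`: the supremum in `[0, ∞]` of all real `i ≥ 0` with `G^i ≠ {id}`
(so it is `0` for the trivial extension). -/
noncomputable def ramConductor : ENNReal :=
  ⨆ (i : ℝ) (_ : 0 ≤ i ∧ upperGroup A K L i ≠ ⊥), ENNReal.ofReal i

end Ramification

section Witt

variable (p : ℕ) [Fact p.Prime] (k : Type*) [Field k] [CharP k p]

instance charZero_wittVector : CharZero (WittVector p k) := by
  obtain ⟨q, hq⟩ := CharP.exists (WittVector p k)
  rcases CharP.char_is_prime_or_zero (WittVector p k) q with h | rfl
  · have h1 : ((q : ℕ) : k) = 0 := by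
      rw [← map_natCast (WittVector.constantCoeff (p := p) (R := k)), CharP.cast_eq_zero, map_zero]
    rw [CharP.cast_eq_zero_iff k p, Nat.prime_dvd_prime_iff_eq Fact.out h] at h1
    exact absurd (h1 ▸ CharP.cast_eq_zero (WittVector p k) q) (WittVector.p_nonzero p k)
  · exact CharP.charP_to_charZero _

instance isAdicComplete_wittVector [PerfectRing k p] :
    IsAdicComplete (maximalIdeal (WittVector p k)) (WittVector p k) := by
  rw [(WittVector.irreducible p (k := k)).maximalIdeal_eq]
  infer_instance

/-- The field `K_0 = Frac(W(k))`. -/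
abbrev BaseField : Type _ := FractionRing (WittVector p k)

/-- An algebraic closure of `K_0`. -/
abbrev ClosedField : Type _ := AlgebraicClosure (BaseField p k)

/-- The field `K_n = K_0(ζ_{p^n})`, generated over `K_0` by the `p^n`-th roots of unity. -/
noncomputable def cyclotomicLayer (n : ℕ) : IntermediateField (BaseField p k) (ClosedField p k) :=
  IntermediateField.adjoin (BaseField p k) {z : ClosedField p k | z ^ p ^ n = 1}

/-- The field `K_d(x)`; for `x` with `x ^ p ^ c = α` this is `K_d` with a `p^c`-th root of `α`
adjoined. -/
noncomputable def kummerLayer (d : ℕ) (x : ClosedField p k) :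
    IntermediateField (BaseField p k) (ClosedField p k) :=
  cyclotomicLayer p k d ⊔ IntermediateField.adjoin (BaseField p k) {x}

/-- The Galois closure of `K_d(x)` over `K_0`. -/
noncomputable def kummerClosure (d : ℕ) (x : ClosedField p k) :
    IntermediateField (BaseField p k) (ClosedField p k) :=
  IntermediateField.normalClosure (BaseField p k) (kummerLayer p k d x) (ClosedField p k)

instance finiteDimensional_cyclotomicLayer (n : ℕ) :
    FiniteDimensional (BaseField p k) (cyclotomicLayer p k n) := by
  have hpos : 0 < p ^ n := pow_pos (Nat.Prime.pos Fact.out) n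
  have : Finite {z : ClosedField p k | z ^ p ^ n = 1} := by
    have h := (Polynomial.nthRootsFinset (p ^ n) (1 : ClosedField p k)).finite_toSet
    refine h.subset fun z hz => ?_
    simpa [Polynomial.mem_nthRootsFinset hpos] using hz
  exact IntermediateField.finiteDimensional_adjoin fun x _ => Algebra.IsIntegral.isIntegral x

instance finiteDimensional_kummerLayer (d : ℕ) (x : ClosedField p k) :
    FiniteDimensional (BaseField p k) (kummerLayer p k d x) := by
  have := IntermediateField.adjoin.finiteDimensional
    (Algebra.IsIntegral.isIntegral (R := BaseField p k) x)
  exact IntermediateField.finiteDimensional_sup _ _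

instance finiteDimensional_kummerClosure (d : ℕ) (x : ClosedField p k) :
    FiniteDimensional (BaseField p k) (kummerClosure p k d x) :=
  normalClosure.is_finiteDimensional (BaseField p k) (kummerLayer p k d x) (ClosedField p k)

end Witt

end LocalRamification

/-!
Suppose that `Gⁱ ≠ 1`, and let `π` be a uniformizer of `L`, which generates its ring of integers
over `W = W(k)`. Choose `g ≠ 1` with `g π` as close to `π` as possible. The polynomial
`∏ₕ (X - h π)`, hence every relation over `W` satisfied by `π`, then vanishes modulo
`ρ = (g π - π) ∏_{h ≠ 1} (h π - π)` along the whole segment from `π` to `g π`. Since the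
ramification index is at most `|G|`, the formula for the Herbrand function shows that `ρ` has
valuation at least `i + 1` on the scale where `p` has valuation `1`.

Gauss's lemma for polynomials in the parameter of the segment turns this into a form of Krasner's
lemma: if `F` splits and `F(b) = 0`, then `ρ` divides `F'(b) (g b - b)`. Two distinct `pⁿ`-th roots
of the same element differ by a divisor of `(ζₚ - 1)` times one of them, so if `i` exceeds the
claimed bound, `g` fixes first the roots of unity of order `p ^ d` and then all `pᶜ`-th roots of
conjugates of `α`. These generate `L`, whence `g = 1`, a contradiction.
-/

namespace LocalRamification

open IsLocalRing Polynomial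

section GaussLemma

variable {R : Type*} [CommRing R] [UniqueFactorizationMonoid R] {a : R}

theorem C_dvd_C_coeff_mul {P Q : R[X]} (h : C a ∣ P * Q) (n : ℕ) : C a ∣ C (P.coeff n) * Q := by
  obtain ⟨_⟩ : Nonempty (NormalizedGCDMonoid R) := inferInstance
  rw [← dvd_content_iff_C_dvd] at h ⊢
  calc a ∣ (P * Q).content := h
    _ ∣ P.content * Q.content := (associated_content_mul P Q).dvd
    _ ∣ P.coeff n * Q.content := mul_dvd_mul_right (content_dvd_coeff n) _
    _ ∣ (C (P.coeff n) * Q).content := (associated_content_C_mul _ Q).symm.dvd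

theorem C_dvd_C_eval_mul_of_C_dvd_comp_mul {F Q : R[X]} (hF : F.Splits) :
    ∀ {H : R[X]}, C a ∣ F.comp Q * H → C a ∣ C (F.eval (Q.eval 0)) * H := by
  induction hF using Submonoid.closure_induction with
  | mem F hF =>
    intro H h
    rcases hF with ⟨r, rfl⟩ | ⟨r, rfl⟩
    · simpa using h
    · simpa [coeff_zero_eq_eval_zero] using C_dvd_C_coeff_mul h 0
  | one => simp
  | mul F G _ _ ihF ihG =>
    intro H h
    rw [mul_comp, mul_assoc] at h
    have hF := ihF h
    rw [mul_left_comm] at hF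
    simpa [mul_assoc, mul_left_comm] using ihG hF

theorem C_dvd_C_eval_derivative_mul [IsDomain R] {F Q : R[X]} (hF : F.Splits)
    (hroot : F.IsRoot (Q.eval 0)) (h : C a ∣ F.comp Q) :
    C a ∣ C (F.derivative.eval (Q.eval 0)) * (Q - C (Q.eval 0)) := by
  set x₀ := Q.eval 0 with hx₀
  obtain ⟨G, rfl⟩ := dvd_iff_isRoot.2 hroot
  have hGQ : C a ∣ G.comp Q * (Q - C x₀) := by simpa [mul_comm] using h
  have hderiv : ((X - C x₀) * G).derivative.eval x₀ = G.eval x₀ := by simp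
  rw [hderiv, hx₀]
  exact C_dvd_C_eval_mul_of_C_dvd_comp_mul (splits_X_sub_C_mul_iff.1 hF) hGQ

end GaussLemma

section Segment

variable {R : Type*} [CommRing R]

/-- The segment from `x` (at `X = 0`) to `y` (at `X = 1`). -/
noncomputable def segmentPoly (x y : R) : R[X] :=
  C x + C (y - x) * X

theorem C_dvd_segmentPoly {a x y : R} (hx : a ∣ x) (hy : a ∣ y) : C a ∣ segmentPoly x y :=
  dvd_add (map_dvd C hx) ((map_dvd C (dvd_sub hy hx)).mul_right X)

variable {W : Type*} [CommRing W] [Algebra W R]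

theorem eval_aeval_polynomial (r : R) (Q : R[X]) (P : W[X]) :
    (aeval Q P).eval r = aeval (Q.eval r) P :=
  (aeval_algHom_apply ((aeval r : R[X] →ₐ[R] R).restrictScalars W) Q P).symm

theorem map_comp_eq (F : W[X]) (Q : R[X]) : (F.map (algebraMap W R)).comp Q = aeval Q F :=
  eval₂_map ..

theorem eval_zero_aeval_segmentPoly (x y : R) (P : W[X]) :
    (aeval (segmentPoly x y) P).eval 0 = aeval x P := by
  rw [eval_aeval_polynomial]
  simp [segmentPoly]

theorem eval_one_aeval_segmentPoly (x y : R) (P : W[X]) :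
    (aeval (segmentPoly x y) P).eval 1 = aeval y P := by
  rw [eval_aeval_polynomial]
  simp [segmentPoly]

/-- Every polynomial relation over `W` satisfied by `π` (hence by `σ π`) holds modulo `ρ` along
the whole segment from `π` to `σ π`. -/
def RelationsVanishModulo (σ : R →ₐ[W] R) (π ρ : R) : Prop :=
  ∀ P : W[X], aeval π P = 0 → C ρ ∣ aeval (segmentPoly π (σ π)) P

variable [IsDomain R] [UniqueFactorizationMonoid R] {σ : R →ₐ[W] R} {π ρ : R}

theorem RelationsVanishModulo.C_dvd_aeval_derivative_mul (hρ : RelationsVanishModulo σ π ρ)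
    {F : W[X]} (hF : (F.map (algebraMap W R)).Splits) {P : W[X]} (hroot : aeval (aeval π P) F = 0) :
    C ρ ∣ C (aeval (aeval π P) F.derivative) *
      (aeval (segmentPoly π (σ π)) P - C (aeval π P)) := by
  have h0 := eval_zero_aeval_segmentPoly π (σ π) P
  have hcomp : C ρ ∣ (F.map (algebraMap W R)).comp (aeval (segmentPoly π (σ π)) P) := by
    have h := hρ (F.comp P) (by rw [aeval_comp, hroot])
    rwa [aeval_comp, ← map_comp_eq] at h
  have h := C_dvd_C_eval_derivative_mul hF (by rwa [h0, IsRoot, eval_map_algebraMap]) hcomp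
  rwa [h0, derivative_map, eval_map_algebraMap] at h

theorem RelationsVanishModulo.dvd_aeval_derivative_mul (hρ : RelationsVanishModulo σ π ρ)
    (hπ : Function.Surjective (aeval π : W[X] →ₐ[W] R)) {F : W[X]}
    (hF : (F.map (algebraMap W R)).Splits) {b : R} (hroot : aeval b F = 0) :
    ρ ∣ aeval b F.derivative * (σ b - b) := by
  obtain ⟨P, rfl⟩ := hπ b
  simpa [eval_one_aeval_segmentPoly, aeval_algHom_apply] using
    eval_dvd (x := 1) (hρ.C_dvd_aeval_derivative_mul hF hroot)

end Segment

section RootsOfUnity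

variable {R : Type*} [CommRing R] [IsDomain R] {p : ℕ} [Fact p.Prime]

theorem sub_one_dvd_of_pow_prime_pow_eq_one {n : ℕ} {ζ ξ : R} (hξ : IsPrimitiveRoot ξ p)
    (hζ : ζ ^ p ^ n = 1) (hζ1 : ζ ≠ 1) : ζ - 1 ∣ ξ - 1 := by
  have hp : p.Prime := Fact.out
  obtain ⟨k, -, hord⟩ := (Nat.dvd_prime_pow hp).1 (orderOf_dvd_of_pow_eq_one hζ)
  obtain ⟨k, rfl⟩ : ∃ j, k = j + 1 := Nat.exists_eq_succ_of_ne_zero fun h => hζ1 <| by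
    rwa [h, pow_zero, orderOf_eq_one_iff] at hord
  have hζk : IsPrimitiveRoot (ζ ^ p ^ k) p :=
    (hord ▸ IsPrimitiveRoot.orderOf ζ).pow (pow_pos hp.pos _) (pow_succ p k)
  obtain ⟨i, -, hi, rfl⟩ := hζk.isPrimitiveRoot_iff.1 hξ
  exact (sub_one_dvd_pow_sub_one ζ _).trans (hζk.associated_sub_one_pow_sub_one_of_coprime hi).dvd

theorem sub_dvd_mul_of_pow_prime_pow_eq {n : ℕ} {x y η ξ : R} (hη : IsPrimitiveRoot η (p ^ n))
    (hξ : IsPrimitiveRoot ξ p) (hxy : y ^ p ^ n = x ^ p ^ n) (hne : y ≠ x) :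
    y - x ∣ (ξ - 1) * x := by
  have hpn : 0 < p ^ n := pow_pos (Fact.out : p.Prime).pos n
  have hroot : eval y (X ^ p ^ n - C (x ^ p ^ n)) = 0 := by simp [hxy]
  rw [X_pow_sub_C_eq_prod hη hpn rfl, eval_prod, Finset.prod_eq_zero_iff] at hroot
  obtain ⟨i, -, hi⟩ := hroot
  obtain rfl : y = η ^ i * x := by simpa [sub_eq_zero] using hi
  have hηi : η ^ i - 1 ∣ ξ - 1 := sub_one_dvd_of_pow_prime_pow_eq_one hξ (n := n)
    (by rw [← pow_mul, mul_comm, pow_mul, hη.pow_eq_one, one_pow])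
    (fun h => hne (by rw [h, one_mul]))
  simpa [sub_mul] using mul_dvd_mul_right hηi x

theorem aeval_cyclotomic_eq_zero (W : Type*) [CommRing W] [Algebra W R] {n : ℕ} {ζ : R}
    (hζ : IsPrimitiveRoot ζ (p ^ n)) : aeval ζ (cyclotomic (p ^ n) W) = 0 := by
  rw [aeval_def, ← eval_map, map_cyclotomic]
  exact hζ.isRoot_cyclotomic (pow_pos (Fact.out : p.Prime).pos _)

theorem associated_aeval_derivative_cyclotomic_mul (W : Type*) [CommRing W] [Algebra W R]
    {n : ℕ} {ζ : R} (hζ : IsPrimitiveRoot ζ (p ^ (n + 1))) :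
    Associated (aeval ζ (cyclotomic (p ^ (n + 1)) W).derivative * (ζ ^ p ^ n - 1))
      ((p : R) ^ (n + 1)) := by
  have hΦ : aeval ζ (cyclotomic (p ^ (n + 1)) W) = 0 :=
    aeval_cyclotomic_eq_zero W hζ
  have hmul : aeval ζ (cyclotomic (p ^ (n + 1)) W).derivative * (ζ ^ p ^ n - 1) =
      (p : R) ^ (n + 1) * ζ ^ (p ^ (n + 1) - 1) := by
    simpa [hΦ, derivative_X_pow] using
      congrArg (fun F => aeval ζ F.derivative) (cyclotomic_prime_pow_mul_X_pow_sub_one W p n)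
  rw [hmul]
  exact associated_mul_unit_left _ _ ((hζ.isUnit (pow_pos (Fact.out : p.Prime).pos _).ne').pow _)

theorem splits_map_cyclotomic (W : Type*) [CommRing W] [Algebra W R] {n : ℕ} {ζ : R}
    (hζ : IsPrimitiveRoot ζ n) : ((cyclotomic n W).map (algebraMap W R)).Splits := by
  rw [map_cyclotomic, cyclotomic_eq_prod_X_sub_primitiveRoots hζ]
  exact Splits.prod fun ξ _ => Splits.X_sub_C ξ

theorem splits_X_pow_sub_C_of_isPrimitiveRoot {n : ℕ} (hn : 0 < n) {η : R}
    (hη : IsPrimitiveRoot η n) (x : R) : (X ^ n - C (x ^ n)).Splits := by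
  rw [X_pow_sub_C_eq_prod hη hn rfl]
  exact Splits.prod fun i _ => Splits.X_sub_C _

theorem C_dvd_C_mul_sub_of_C_dvd_pow_sub [UniqueFactorizationMonoid R] {a x η : R} {n : ℕ}
    (hn : 0 < n) (hη : IsPrimitiveRoot η n) {Q : R[X]} (hQ : Q.eval 0 = x)
    (h : C a ∣ Q ^ n - C (x ^ n)) : C a ∣ C (n * x ^ (n - 1)) * (Q - C x) := by
  subst hQ
  have hcomp : (X ^ n - C (Q.eval 0 ^ n)).comp Q = Q ^ n - C (Q.eval 0 ^ n) := by
    rw [sub_comp, pow_comp, X_comp, C_comp]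
  have hroot : (X ^ n - C (Q.eval 0 ^ n)).IsRoot (Q.eval 0) := by
    rw [IsRoot, eval_sub, eval_pow, eval_X, eval_C, sub_self]
  have hderiv : (derivative (X ^ n - C (Q.eval 0 ^ n))).eval (Q.eval 0) =
      n * Q.eval 0 ^ (n - 1) := by
    rw [derivative_sub, derivative_C, sub_zero, derivative_X_pow]
    simp
  rw [← hderiv]
  exact C_dvd_C_eval_derivative_mul (splits_X_pow_sub_C_of_isPrimitiveRoot hn hη _) hroot
    (hcomp ▸ h)

end RootsOfUnity

section Radicals

variable {W R : Type*} [CommRing W] [CommRing R] [Algebra W R]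

theorem mul_sub_dvd_aeval_sub (s A B : R) (hA : s ∣ A) (hB : s ∣ B) (b : ℕ) (V : W[X]) :
    s ^ b * (A - B) ∣ s * (aeval A (X ^ b * V) - aeval B (X ^ b * V)) := by
  obtain ⟨A', rfl⟩ := hA
  obtain ⟨B', rfl⟩ := hB
  have hpow : s ^ b * (s * A' - s * B') ∣ s * ((s * A') ^ b - (s * B') ^ b) := by
    obtain ⟨z, hz⟩ := sub_dvd_pow_sub_pow A' B' b
    exact ⟨z, by linear_combination (s ^ (b + 1)) * hz⟩
  have hV : s * A' - s * B' ∣ aeval (s * A') V - aeval (s * B') V := by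
    rw [aeval_def, aeval_def, ← eval_map, ← eval_map]
    exact sub_dvd_eval_sub _ _ _
  have hsplit : s * (aeval (s * A') (X ^ b * V) - aeval (s * B') (X ^ b * V)) =
      s * ((s * A') ^ b - (s * B') ^ b) * aeval (s * A') V +
        s ^ b * (aeval (s * A') V - aeval (s * B') V) * (s * B' ^ b) := by
    simp only [map_mul, map_pow, aeval_X]
    ring
  rw [hsplit]
  exact dvd_add (hpow.mul_right _) ((mul_dvd_mul_left _ hV).mul_right _)

end Radicals

section Uniformizer

variable {W R : Type*} [CommRing W] [CommRing R] [IsDomain R] [IsDiscreteValuationRing R]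
  [Algebra W R] {σ : R →ₐ[W] R} {π ρ : R} {p : ℕ} [Fact p.Prime]

theorem uniformizer_mul_dvd_of_not_dvd {a b : R} (hπ : Irreducible π) (h : ¬ a ∣ b) :
    π * b ∣ a := by
  rw [← IsDiscreteValuationRing.addVal_le_iff_dvd, not_le, ← ENat.add_one_le_iff] at h
  · rw [← IsDiscreteValuationRing.addVal_le_iff_dvd, AddValuation.map_mul,
      IsDiscreteValuationRing.addVal_uniformizer hπ, add_comm]
    exact h
  · exact h.ne_top

theorem exists_irreducible_pow_mul_aeval_eq (hπ : Irreducible π)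
    (hgen : Function.Surjective (aeval π : W[X] →ₐ[W] R)) {b : R} (hb : b ≠ 0) :
    ∃ (k : ℕ) (P : W[X]), Associated b (π ^ k) ∧ aeval π (X ^ k * P) = b := by
  obtain ⟨k, hk⟩ := IsDiscreteValuationRing.associated_pow_irreducible hb hπ
  obtain ⟨ε, hε⟩ := hk.symm
  obtain ⟨P, hP⟩ := hgen ε
  exact ⟨k, P, hk, by rw [map_mul, map_pow, aeval_X, hP, hε]⟩

theorem RelationsVanishModulo.map_eq_of_isPrimitiveRoot (hρ : RelationsVanishModulo σ π ρ)
    (hgen : Function.Surjective (aeval π : W[X] →ₐ[W] R)) {n : ℕ} {ζ : R}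
    (hζ : IsPrimitiveRoot ζ (p ^ (n + 1))) (hn : ¬ ρ ∣ (p : R) ^ (n + 1)) : σ ζ = ζ := by
  have hp : p.Prime := Fact.out
  by_contra hne
  have hξ : IsPrimitiveRoot (ζ ^ p ^ n) p := hζ.pow (pow_pos hp.pos _) (pow_succ p n)
  have hroot : aeval ζ (cyclotomic (p ^ (n + 1)) W) = 0 := aeval_cyclotomic_eq_zero W hζ
  refine hn ?_
  calc ρ ∣ aeval ζ (cyclotomic (p ^ (n + 1)) W).derivative * (σ ζ - ζ) :=
        hρ.dvd_aeval_derivative_mul hgen (splits_map_cyclotomic W hζ) hroot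
    _ ∣ aeval ζ (cyclotomic (p ^ (n + 1)) W).derivative * ((ζ ^ p ^ n - 1) * ζ) :=
        mul_dvd_mul_left _ (sub_dvd_mul_of_pow_prime_pow_eq hζ hξ
          (by rw [← map_pow, hζ.pow_eq_one, map_one]) hne)
    _ ∣ (p : R) ^ (n + 1) := by
        rw [← mul_assoc, (hζ.isUnit (pow_pos hp.pos _).ne').mul_right_dvd]
        exact (associated_aeval_derivative_cyclotomic_mul W hζ).dvd

theorem RelationsVanishModulo.C_pow_mul_dvd (hρ : RelationsVanishModulo σ π ρ) (hπ0 : π ≠ 0)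
    (hσπ : π ∣ σ π) {k : ℕ} {P : W[X]} (h : aeval π (X ^ k * P) = 0) :
    C (π ^ k * ρ) ∣ aeval (segmentPoly π (σ π)) (X ^ k * P) := by
  have hP : aeval π P = 0 := by simpa [hπ0] using h
  rw [map_mul, map_pow, map_mul, map_pow, aeval_X]
  exact mul_dvd_mul (pow_dvd_pow_of_dvd (C_dvd_segmentPoly dvd_rfl hσπ) k) (hρ P hP)

theorem RelationsVanishModulo.C_dvd_pow_sub_aeval (hρ : RelationsVanishModulo σ π ρ)
    (hπ0 : π ≠ 0) (hσπ : π ∣ σ π) {w q N a : ℕ} (hk : w * N = q * a) {P Q U : W[X]}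
    (h : aeval π (X ^ w * P) ^ N = aeval (aeval π (X ^ q * Q)) (X ^ a * U)) :
    C (π ^ (q * a) * ρ) ∣ aeval (segmentPoly π (σ π)) (X ^ w * P) ^ N -
      aeval (aeval (segmentPoly π (σ π)) (X ^ q * Q)) (X ^ a * U) := by
  have hfactor : (X ^ w * P) ^ N - (X ^ a * U).comp (X ^ q * Q) =
      X ^ (q * a) * (P ^ N - Q ^ a * U.comp (X ^ q * Q)) := by
    simp only [mul_comp, pow_comp, X_comp]
    rw [mul_pow, mul_pow, ← pow_mul, ← pow_mul, hk]
    ring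
  have hzero : aeval π (X ^ (q * a) * (P ^ N - Q ^ a * U.comp (X ^ q * Q))) = 0 := by
    rw [← hfactor, map_sub, map_pow, aeval_comp, h, sub_self]
  have := hρ.C_pow_mul_dvd hπ0 hσπ hzero
  rwa [← hfactor, map_sub, map_pow, aeval_comp] at this

theorem RelationsVanishModulo.C_dvd_cyclotomic (hρ : RelationsVanishModulo σ π ρ)
    {n : ℕ} {ζ : R} (hζ : IsPrimitiveRoot ζ (p ^ (n + 1))) {P : W[X]} (hP : aeval π P = ζ - 1)
    (hdvd : C (ζ - 1) ∣ aeval (segmentPoly π (σ π)) P) {b : ℕ} {r : W} {V : W[X]} :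
    C ((ζ - 1) ^ b * ρ) ∣ C ((ζ - 1) * aeval ζ (cyclotomic (p ^ (n + 1)) W).derivative) *
      (aeval (aeval (segmentPoly π (σ π)) P) (C r + X ^ b * V) -
        C (aeval (ζ - 1) (C r + X ^ b * V))) := by
  set S := segmentPoly π (σ π)
  set Φ' := aeval ζ (cyclotomic (p ^ (n + 1)) W).derivative
  have hlift : aeval π (1 + P) = ζ := by rw [map_add, map_one, hP]; ring
  have hcyc : C ρ ∣ C Φ' * (aeval S P - C (ζ - 1)) := by
    have h := hρ.C_dvd_aeval_derivative_mul (splits_map_cyclotomic W hζ) (P := 1 + P)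
      (by rw [hlift]; exact aeval_cyclotomic_eq_zero W hζ)
    rw [hlift, map_add, map_one] at h
    convert h using 2
    rw [C_sub, C_1]
    ring
  have hvar := mul_sub_dvd_aeval_sub (C (ζ - 1)) (aeval S P) (C (ζ - 1)) hdvd dvd_rfl b V
  have hconst : aeval (C (ζ - 1)) (X ^ b * V) = C (aeval (ζ - 1) (X ^ b * V)) :=
    aeval_algebraMap_apply R[X] (ζ - 1) (X ^ b * V)
  calc C ((ζ - 1) ^ b * ρ) = C (ζ - 1) ^ b * C ρ := by rw [C_mul, C_pow]
    _ ∣ C (ζ - 1) ^ b * (C Φ' * (aeval S P - C (ζ - 1))) := mul_dvd_mul_left _ hcyc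
    _ = C Φ' * (C (ζ - 1) ^ b * (aeval S P - C (ζ - 1))) := mul_left_comm _ _ _
    _ ∣ C Φ' * (C (ζ - 1) * (aeval (aeval S P) (X ^ b * V) - aeval (C (ζ - 1)) (X ^ b * V))) :=
        mul_dvd_mul_left _ hvar
    _ = C ((ζ - 1) * Φ') * (aeval (aeval S P) (C r + X ^ b * V) -
          C (aeval (ζ - 1) (C r + X ^ b * V))) := by
        rw [hconst, map_add, map_add, aeval_C, aeval_C, C_add, C_mul, Polynomial.algebraMap_apply]
        ring

theorem RelationsVanishModulo.C_dvd_aeval_sub (hρ : RelationsVanishModulo σ π ρ)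
    (hπ : Irreducible π) {n c : ℕ} {ζ : R} (hζ : IsPrimitiveRoot ζ (p ^ (n + 1))) {a m : ℕ} {r : W}
    {U V : W[X]} (hU : IsUnit (aeval (ζ - 1) U)) (hUV : X ^ a * U = C r + X ^ (a + m) * V)
    {P : W[X]} (hP : aeval π P = ζ - 1) (hdvd : C (ζ - 1) ∣ aeval (segmentPoly π (σ π)) P)
    (h : ¬ (ζ - 1) ^ m * ρ ∣ (ζ - 1) * (p : R) ^ (n + 1 + c)) :
    C (π * ((p : R) ^ c * (ζ ^ p ^ n - 1) * aeval (ζ - 1) (X ^ a * U))) ∣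
      aeval (aeval (segmentPoly π (σ π)) P) (X ^ a * U) - C (aeval (ζ - 1) (X ^ a * U)) := by
  set Φ' := aeval ζ (cyclotomic (p ^ (n + 1)) W).derivative
  have hΦ' : Associated (Φ' * (ζ ^ p ^ n - 1)) ((p : R) ^ (n + 1)) :=
    associated_aeval_derivative_cyclotomic_mul W hζ
  have hp0 : (ζ - 1) * (p : R) ^ (n + 1 + c) ≠ 0 := fun h0 => h (h0 ▸ dvd_zero _)
  have hΦ'0 : Φ' ≠ 0 := fun h0 => by
    rw [h0, zero_mul, Associated.comm, associated_zero_iff_eq_zero] at hΦ'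
    exact hp0 (by rw [pow_add, hΦ', zero_mul, mul_zero])
  have hdepth : (ζ - 1) * Φ' * (π * ((p : R) ^ c * (ζ ^ p ^ n - 1) * aeval (ζ - 1) (X ^ a * U))) ∣
      (ζ - 1) ^ (a + m) * ρ :=
    calc (ζ - 1) * Φ' * (π * ((p : R) ^ c * (ζ ^ p ^ n - 1) * aeval (ζ - 1) (X ^ a * U)))
      _ = (ζ - 1) ^ a * (π * ((ζ - 1) * (Φ' * (ζ ^ p ^ n - 1) * p ^ c))) * aeval (ζ - 1) U := by
          rw [map_mul, map_pow, aeval_X]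
          ring
      _ ∣ (ζ - 1) ^ a * (π * ((ζ - 1) * (p : R) ^ (n + 1 + c))) := by
          rw [hU.mul_right_dvd, pow_add]
          gcongr
          exact hΦ'.dvd
      _ ∣ (ζ - 1) ^ a * ((ζ - 1) ^ m * ρ) :=
          mul_dvd_mul_left _ (uniformizer_mul_dvd_of_not_dvd hπ h)
      _ = (ζ - 1) ^ (a + m) * ρ := by ring
  rw [hUV] at hdepth ⊢
  refine (mul_dvd_mul_iff_left (C_ne_zero.2 (mul_ne_zero (left_ne_zero_of_mul hp0) hΦ'0))).1 ?_
  rw [← C_mul]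
  exact (_root_.map_dvd C hdepth).trans (hρ.C_dvd_cyclotomic hζ hP hdvd)

theorem RelationsVanishModulo.exists_C_dvd_pow_sub_C (hρ : RelationsVanishModulo σ π ρ)
    (hπ : Irreducible π) (hgen : Function.Surjective (aeval π : W[X] →ₐ[W] R)) (hσπ : π ∣ σ π)
    {n c : ℕ} {ζ : R} (hζ : IsPrimitiveRoot ζ (p ^ (n + 1)))
    {a m : ℕ} {r : W} {U V : W[X]} (hU : IsUnit (aeval (ζ - 1) U))
    (hUV : X ^ a * U = C r + X ^ (a + m) * V) {x : R} (hx0 : x ≠ 0)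
    (hx : x ^ p ^ c = aeval (ζ - 1) (X ^ a * U))
    (h₂ : ¬ ρ ∣ (p : R) ^ c * (ζ ^ p ^ n - 1))
    (h₃ : ¬ (ζ - 1) ^ m * ρ ∣ (ζ - 1) * (p : R) ^ (n + 1 + c)) :
    ∃ P : W[X], aeval π P = x ∧ C (π * ((p : R) ^ c * (ζ ^ p ^ n - 1) * x ^ p ^ c)) ∣
      aeval (segmentPoly π (σ π)) P ^ p ^ c - C (x ^ p ^ c) := by
  have hl : ζ - 1 ≠ 0 := fun h0 => h₃ (by rw [h0, zero_mul]; exact dvd_zero _)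
  obtain ⟨q, Q, hq, hQ⟩ := exists_irreducible_pow_mul_aeval_eq hπ hgen hl
  obtain ⟨w, P, hw, hP⟩ := exists_irreducible_pow_mul_aeval_eq hπ hgen hx0
  have hxq : Associated (x ^ p ^ c) (π ^ (q * a)) := by
    rw [hx, map_mul, map_pow, aeval_X, pow_mul]
    exact (associated_mul_unit_left _ _ hU).trans hq.pow_pow
  have hwq : w * p ^ c = q * a := by
    have hassoc := hw.pow_pow (n := p ^ c).symm.trans hxq
    rw [← pow_mul, ← IsDiscreteValuationRing.addVal_eq_iff_associated, hπ.addVal_pow,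
      hπ.addVal_pow] at hassoc
    exact_mod_cast hassoc
  have hdvd : C (ζ - 1) ∣ aeval (segmentPoly π (σ π)) (X ^ q * Q) := by
    rw [map_mul, map_pow, aeval_X]
    refine Dvd.dvd.mul_right ((_root_.map_dvd C hq.dvd).trans ?_) _
    rw [C_pow]
    exact pow_dvd_pow_of_dvd (C_dvd_segmentPoly dvd_rfl hσπ) q
  refine ⟨X ^ w * P, hP, ?_⟩
  rw [← sub_add_sub_cancel _ (aeval (aeval (segmentPoly π (σ π)) (X ^ q * Q)) (X ^ a * U))]
  refine dvd_add (Dvd.dvd.trans ?_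
    (hρ.C_dvd_pow_sub_aeval hπ.ne_zero hσπ hwq (by rw [hP, hQ, hx]))) ?_
  · rw [← mul_assoc, mul_comm]
    exact _root_.map_dvd C (mul_dvd_mul hxq.dvd (uniformizer_mul_dvd_of_not_dvd hπ h₂))
  · rw [hx]
    exact hρ.C_dvd_aeval_sub hπ hζ hU hUV hQ hdvd h₃

theorem RelationsVanishModulo.map_eq_of_pow_eq (hρ : RelationsVanishModulo σ π ρ)
    (hπ : Irreducible π) (hgen : Function.Surjective (aeval π : W[X] →ₐ[W] R)) (hσπ : π ∣ σ π)
    {n c : ℕ} {ζ η : R} (hζ : IsPrimitiveRoot ζ (p ^ (n + 1))) (hη : IsPrimitiveRoot η (p ^ c))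
    {a m : ℕ} {r : W} {U V : W[X]} (hU : IsUnit (aeval (ζ - 1) U))
    (hUV : X ^ a * U = C r + X ^ (a + m) * V) {x : R}
    (hx : x ^ p ^ c = aeval (ζ - 1) (X ^ a * U)) (h₁ : ¬ ρ ∣ (p : R) ^ (n + 1))
    (h₂ : ¬ ρ ∣ (p : R) ^ c * (ζ ^ p ^ n - 1))
    (h₃ : ¬ (ζ - 1) ^ m * ρ ∣ (ζ - 1) * (p : R) ^ (n + 1 + c)) : σ x = x := by
  have hp : p.Prime := Fact.out
  have hpc : 0 < p ^ c := pow_pos hp.pos c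
  rcases eq_or_ne x 0 with rfl | hx0
  · exact map_zero σ
  by_contra hne
  have hσx : (σ x) ^ p ^ c = x ^ p ^ c := by
    rw [← map_pow, hx, ← aeval_algHom_apply, map_sub, map_one,
      hρ.map_eq_of_isPrimitiveRoot hgen hζ h₁]
  have hξ : IsPrimitiveRoot (ζ ^ p ^ n) p := hζ.pow (pow_pos hp.pos _) (pow_succ p n)
  obtain ⟨P, rfl, hP⟩ := hρ.exists_C_dvd_pow_sub_C hπ hgen hσπ hζ hU hUV hx0 hx h₂ h₃
  set x := aeval π P
  have hkrasner : π * ((p : R) ^ c * (ζ ^ p ^ n - 1) * x ^ p ^ c) ∣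
      (p : R) ^ c * x ^ (p ^ c - 1) * (σ x - x) := by
    have h := C_dvd_C_mul_sub_of_C_dvd_pow_sub hpc hη
      (eval_zero_aeval_segmentPoly π (σ π) P) hP
    simpa [eval_one_aeval_segmentPoly, aeval_algHom_apply] using eval_dvd (x := 1) h
  have hself : π * ((p : R) ^ c * (ζ ^ p ^ n - 1) * x ^ p ^ c) ∣
      (p : R) ^ c * (ζ ^ p ^ n - 1) * x ^ p ^ c :=
    calc π * ((p : R) ^ c * (ζ ^ p ^ n - 1) * x ^ p ^ c) ∣
          (p : R) ^ c * x ^ (p ^ c - 1) * (σ x - x) := hkrasner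
      _ ∣ (p : R) ^ c * x ^ (p ^ c - 1) * ((ζ ^ p ^ n - 1) * x) :=
          mul_dvd_mul_left _ (sub_dvd_mul_of_pow_prime_pow_eq hη hξ hσx hne)
      _ = (p : R) ^ c * (ζ ^ p ^ n - 1) * x ^ p ^ c := by
          rw [← pow_sub_one_mul hpc.ne' x]
          ring
  have hne0 : (p : R) ^ c * (ζ ^ p ^ n - 1) * x ^ p ^ c ≠ 0 :=
    mul_ne_zero (fun h0 => h₂ (h0 ▸ dvd_zero _)) (pow_ne_zero _ hx0)
  refine hπ.not_isUnit (isUnit_of_dvd_one ((mul_dvd_mul_iff_right hne0).1 ?_))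
  rwa [one_mul]

end Uniformizer

section Conjugates

variable {G W R : Type*} [Group G] [CommRing W] [CommRing R] [Algebra W R] [MulSemiringAction G R]
  [SMulCommClass G W R] {π : R}

theorem irreducible_smul (g : G) (hπ : Irreducible π) : Irreducible (g • π) :=
  (MulEquiv.irreducible_iff (MulSemiringAction.toRingEquiv G R g)).2 hπ

theorem smul_aeval (g : G) (P : W[X]) : g • aeval π P = aeval (g • π) P :=
  (aeval_algHom_apply (MulSemiringAction.toAlgHom W R g) π P).symm

theorem smul_injective_of_surjective_aeval [FaithfulSMul G R]
    (hgen : Function.Surjective (aeval π : W[X] →ₐ[W] R)) :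
    Function.Injective fun g : G => g • π := fun g h hgh =>
  FaithfulSMul.eq_of_smul_eq_smul (hgen.forall.2 fun P => by
    rw [smul_aeval, smul_aeval, show g • π = h • π from hgh])

variable [IsDomain R] [Fintype G]

theorem prod_X_sub_C_smul_dvd (hπ : Function.Injective fun g : G => g • π) {P : W[X]}
    (hP : aeval π P = 0) : ∏ g : G, (X - C (g • π)) ∣ P.map (algebraMap W R) := by
  rcases eq_or_ne (P.map (algebraMap W R)) 0 with h0 | h0
  · simp [h0]
  have hle : Finset.univ.val.map (fun g : G => g • π) ≤ (P.map (algebraMap W R)).roots := by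
    rw [Multiset.le_iff_subset (Finset.univ.nodup.map hπ)]
    intro x hx
    obtain ⟨g, -, rfl⟩ := Multiset.mem_map.1 hx
    rw [mem_roots h0, IsRoot, eval_map_algebraMap, ← smul_aeval, hP, smul_zero]
  simpa using (Multiset.prod_X_sub_C_dvd_iff_le_roots h0 _).2 hle

theorem relationsVanishModulo_smul [DecidableEq G] (hπ : Function.Injective fun g : G => g • π)
    {g : G} (hg : ∀ h : G, h ≠ 1 → h • π - π ∣ g • π - π) :
    RelationsVanishModulo (MulSemiringAction.toAlgHom W R g) π
      ((g • π - π) * ∏ h ∈ ({1}ᶜ : Finset G), (h • π - π)) := by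
  intro P hP
  have hsegment (h : G) : segmentPoly π (g • π) - C (h • π) =
      C (g • π - π) * X - C (h • π - π) := by
    rw [segmentPoly, C_sub, C_sub]
    ring
  have hprod : ∏ h : G, (segmentPoly π (g • π) - C (h • π)) ∣ aeval (segmentPoly π (g • π)) P := by
    obtain ⟨Q, hQ⟩ := prod_X_sub_C_smul_dvd hπ hP
    refine ⟨Q.comp (segmentPoly π (g • π)), ?_⟩
    rw [← map_comp_eq, hQ, mul_comp, prod_comp]
    simp only [sub_comp, X_comp, C_comp]
  refine Dvd.dvd.trans ?_ hprod
  rw [Fintype.prod_eq_mul_prod_compl 1, C_mul, map_prod]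
  refine mul_dvd_mul ?_ (Finset.prod_dvd_prod_of_dvd _ _ fun h hh => ?_)
  · rw [hsegment, one_smul, sub_self, C_0, sub_zero]
    exact dvd_mul_right _ _
  · rw [hsegment]
    exact dvd_sub ((_root_.map_dvd C (hg h (by simpa using hh))).mul_right X) dvd_rfl

end Conjugates

section Depth

theorem addVal_prod {R ι : Type*} [CommRing R] [IsDomain R] [IsDiscreteValuationRing R]
    (s : Finset ι) (f : ι → R) :
    IsDiscreteValuationRing.addVal R (∏ i ∈ s, f i) =
      ∑ i ∈ s, IsDiscreteValuationRing.addVal R (f i) := by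
  classical
  induction s using Finset.induction_on with
  | empty => simp
  | insert i s hi ih =>
    rw [Finset.prod_insert hi, Finset.sum_insert hi, AddValuation.map_mul, ih]

variable {G R : Type*} [Group G] [CommRing R] [IsDomain R] [IsDiscreteValuationRing R]
  [MulSemiringAction G R] {π : R}

theorem dvd_smul_of_irreducible (hπ : Irreducible π) (g : G) : π ∣ g • π :=
  (IsDiscreteValuationRing.associated_of_irreducible R hπ (irreducible_smul g hπ)).dvd

/-- For `g ≠ 1` and a uniformizer `π` that generates the ring of integers, this is the number
`i_G(g) = v(g π - π)` of ramification theory, so that `g ∈ G_i ↔ i + 1 ≤ i_G(g)`. The value `0` at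
`g = 1`, where `i_G` is infinite, is never used. -/
noncomputable def ramificationDepth (π : R) (g : G) : ℕ :=
  (IsDiscreteValuationRing.addVal R (g • π - π)).toNat

theorem addVal_smul_sub (hπ : Function.Injective fun g : G => g • π) {g : G} (hg : g ≠ 1) :
    IsDiscreteValuationRing.addVal R (g • π - π) = ramificationDepth π g :=
  (ENat.natCast_toNat fun h => hg (hπ (by
    simpa [sub_eq_zero] using IsDiscreteValuationRing.addVal_eq_top_iff.1 h))).symm

theorem one_le_ramificationDepth (hirr : Irreducible π)
    (hπ : Function.Injective fun g : G => g • π) {g : G} (hg : g ≠ 1) :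
    1 ≤ ramificationDepth π g := by
  have h : IsDiscreteValuationRing.addVal R π ≤ ramificationDepth π g := by
    rw [← addVal_smul_sub hπ hg, IsDiscreteValuationRing.addVal_le_iff_dvd]
    exact dvd_sub (dvd_smul_of_irreducible hirr g) dvd_rfl
  rw [IsDiscreteValuationRing.addVal_uniformizer hirr] at h
  exact_mod_cast h

theorem exists_relationsVanishModulo (W : Type*) [CommRing W] [Algebra W R] [SMulCommClass G W R]
    [Fintype G] [DecidableEq G] (hπ : Function.Injective fun g : G => g • π) {g₀ : G}
    (hg₀ : g₀ ≠ 1) :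
    ∃ g : G, g ≠ 1 ∧ ramificationDepth π g₀ ≤ ramificationDepth π g ∧
      ∃ ρ : R, RelationsVanishModulo (MulSemiringAction.toAlgHom W R g) π ρ ∧
        IsDiscreteValuationRing.addVal R ρ =
          (ramificationDepth π g + ∑ h ∈ ({1}ᶜ : Finset G), ramificationDepth π h : ℕ) := by
  obtain ⟨g, hg, hmax⟩ := ({1}ᶜ : Finset G).exists_max_image (ramificationDepth π)
    ⟨g₀, by simpa using hg₀⟩
  simp only [Finset.mem_compl, Finset.mem_singleton] at hg hmax
  refine ⟨g, hg, hmax g₀ hg₀, _, relationsVanishModulo_smul hπ fun h hh => ?_, ?_⟩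
  · rw [← IsDiscreteValuationRing.addVal_le_iff_dvd, addVal_smul_sub hπ hh, addVal_smul_sub hπ hg]
    exact_mod_cast hmax h hh
  · rw [AddValuation.map_mul, addVal_prod, addVal_smul_sub hπ hg, Nat.cast_add, Nat.cast_sum,
      Finset.sum_congr rfl fun h hh => addVal_smul_sub hπ (by simpa using hh)]

theorem addVal_algebraMap_le_card {W : Type*} [CommRing W] [IsDomain W] [IsDiscreteValuationRing W]
    [Algebra W R] [Finite G] [Algebra.IsInvariant W R G] {ϖ : W} (hϖ : Irreducible ϖ) :
    IsDiscreteValuationRing.addVal R (algebraMap W R ϖ) ≤ Nat.card G := by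
  have := Fintype.ofFinite G
  obtain ⟨π, hπ⟩ := IsDiscreteValuationRing.exists_irreducible R
  obtain ⟨a, ha⟩ := Algebra.IsInvariant.isInvariant (A := W) (G := G) (∏ g : G, g • π)
    (Finset.smul_prod_perm π)
  have hval : IsDiscreteValuationRing.addVal R (algebraMap W R a) = Nat.card G := by
    rw [ha, addVal_prod, Finset.sum_congr rfl fun g _ =>
      IsDiscreteValuationRing.addVal_uniformizer (irreducible_smul g hπ)]
    simp
  have hdvd : ϖ ∣ a := by
    rw [← Ideal.mem_span_singleton, ← hϖ.maximalIdeal_eq, mem_maximalIdeal, mem_nonunits_iff]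
    intro hunit
    rw [IsDiscreteValuationRing.addVal_eq_zero_iff.2 (hunit.map _)] at hval
    exact Nat.card_pos.ne (by exact_mod_cast hval)
  rw [← hval, IsDiscreteValuationRing.addVal_le_iff_dvd]
  exact _root_.map_dvd _ hdvd

end Depth

section Herbrand

theorem intervalIntegrable_indicator_Iic (a b c : ℝ) :
    IntervalIntegrable ((Set.Iic c).indicator fun _ => (1 : ℝ)) MeasureTheory.volume a b :=
  intervalIntegrable_iff.2
    ((intervalIntegrable_iff.1 intervalIntegrable_const).indicator measurableSet_Iic)

theorem integral_indicator_Iic {u c : ℝ} (hu : 0 ≤ u) (hc : 0 ≤ c) :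
    ∫ t in (0 : ℝ)..u, (Set.Iic c).indicator (fun _ => (1 : ℝ)) t = min u c := by
  rw [intervalIntegral.integral_of_le hu, MeasureTheory.setIntegral_indicator measurableSet_Iic,
    Set.Ioc_inter_Iic]
  simp [le_min hu hc]

variable {A K L : Type*} [CommRing A] [IsDomain A] [IsDiscreteValuationRing A]
  [IsAdicComplete (maximalIdeal A) A] [Field K] [Algebra A K] [IsFractionRing A K]
  [Field L] [Algebra K L] [Algebra A L] [IsScalarTower A K L]
  [FiniteDimensional K L] [Algebra.IsSeparable K L]
  [IsDiscreteValuationRing (integralClosure A L)] {π : integralClosure A L}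

theorem mem_lowerGroup_iff_le_ramificationDepth (hirr : Irreducible π)
    (hgen : Function.Surjective (aeval π : A[X] →ₐ[A] integralClosure A L))
    (hπ : Function.Injective fun g : Gal(L/K) => g • π) {g : Gal(L/K)} (hg : g ≠ 1) (t : ℝ) :
    g ∈ lowerGroup A K L t ↔ t ≤ (ramificationDepth π g : ℝ) - 1 := by
  have hdepth : g ∈ lowerGroup A K L t ↔ ⌈t⌉₊ + 1 ≤ ramificationDepth π g := by
    rw [← Nat.cast_le (α := ℕ∞), ← addVal_smul_sub hπ hg]
    refine ⟨fun h => h π, fun h => hgen.forall.2 fun P => h.trans ?_⟩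
    rw [smul_aeval, val, IsDiscreteValuationRing.addVal_le_iff_dvd]
    simpa only [eval_map_algebraMap] using
      sub_dvd_eval_sub (g • π) π (P.map (algebraMap A (integralClosure A L)))
  have hone := one_le_ramificationDepth hirr hπ hg
  rw [hdepth, ← Nat.le_sub_iff_add_le hone, Nat.ceil_le, Nat.cast_sub hone, Nat.cast_one]

theorem inv_relIndex_lowerGroup [DecidableEq Gal(L/K)] (hirr : Irreducible π)
    (hgen : Function.Surjective (aeval π : A[X] →ₐ[A] integralClosure A L))
    (hπ : Function.Injective fun g : Gal(L/K) => g • π) (t : ℝ) :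
    ((lowerGroup A K L t).relIndex (lowerGroup A K L 0) : ℝ)⁻¹ =
      (Nat.card Gal(L/K) : ℝ)⁻¹ * (1 + ∑ g ∈ ({1}ᶜ : Finset Gal(L/K)),
        (Set.Iic ((ramificationDepth π g : ℝ) - 1)).indicator (fun _ => (1 : ℝ)) t) := by
  classical
  have htop : lowerGroup A K L 0 = ⊤ := by
    refine (Subgroup.eq_top_iff' _).2 fun g => ?_
    rcases eq_or_ne g 1 with rfl | hg
    · exact one_mem _
    · rw [mem_lowerGroup_iff_le_ramificationDepth hirr hgen hπ hg, sub_nonneg]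
      exact_mod_cast one_le_ramificationDepth hirr hπ hg
  have hcard : (Nat.card (lowerGroup A K L t) : ℝ) = 1 + ∑ g ∈ ({1}ᶜ : Finset Gal(L/K)),
      (Set.Iic ((ramificationDepth π g : ℝ) - 1)).indicator (fun _ => (1 : ℝ)) t := by
    rw [Nat.card_eq_fintype_card, Fintype.card_subtype, Finset.card_filter, Nat.cast_sum,
      Fintype.sum_eq_add_sum_compl 1, if_pos (one_mem _), Nat.cast_one]
    congr 1
    refine Finset.sum_congr rfl fun g hg => ?_
    simp only [mem_lowerGroup_iff_le_ramificationDepth hirr hgen hπ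
      (show g ≠ 1 by simpa using hg), Set.indicator_apply, Set.mem_Iic, Nat.cast_ite,
      Nat.cast_one, Nat.cast_zero]
  rw [htop, Subgroup.relIndex_top_right, ← hcard, ← Subgroup.card_mul_index (lowerGroup A K L t),
    Nat.cast_mul, mul_inv, mul_right_comm, inv_mul_cancel₀ (Nat.cast_ne_zero.2 Nat.card_pos.ne'),
    one_mul]

theorem herbrandPhi_eq [DecidableEq Gal(L/K)] (hirr : Irreducible π)
    (hgen : Function.Surjective (aeval π : A[X] →ₐ[A] integralClosure A L))
    (hπ : Function.Injective fun g : Gal(L/K) => g • π) {u : ℝ} (hu : 0 ≤ u) :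
    herbrandPhi A K L u = (Nat.card Gal(L/K) : ℝ)⁻¹ *
      (u + ∑ g ∈ ({1}ᶜ : Finset Gal(L/K)), min u ((ramificationDepth π g : ℝ) - 1)) := by
  have hint : ∀ g ∈ ({1}ᶜ : Finset Gal(L/K)), IntervalIntegrable
      ((Set.Iic ((ramificationDepth π g : ℝ) - 1)).indicator fun _ => (1 : ℝ))
        MeasureTheory.volume 0 u :=
    fun g _ => intervalIntegrable_indicator_Iic 0 u _
  rw [herbrandPhi]
  simp only [inv_relIndex_lowerGroup hirr hgen hπ]
  rw [intervalIntegral.integral_const_mul, intervalIntegral.integral_add intervalIntegrable_const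
      (by simpa only [Finset.sum_fn] using IntervalIntegrable.sum _ hint),
    intervalIntegral.integral_finsetSum hint, intervalIntegral.integral_const, sub_zero,
    smul_eq_mul, mul_one]
  congr 2
  refine Finset.sum_congr rfl fun g hg => integral_indicator_Iic hu (sub_nonneg.2 ?_)
  exact_mod_cast one_le_ramificationDepth hirr hπ (by simpa using hg)

theorem surjOn_herbrandPhi (hirr : Irreducible π)
    (hgen : Function.Surjective (aeval π : A[X] →ₐ[A] integralClosure A L))
    (hπ : Function.Injective fun g : Gal(L/K) => g • π) :
    Set.SurjOn (herbrandPhi A K L) (Set.Ici 0) (Set.Ici 0) := by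
  classical
  intro i hi
  set n : ℝ := (Nat.card Gal(L/K) : ℝ)
  have hn : 0 < n := Nat.cast_pos.2 Nat.card_pos
  have hni : 0 ≤ n * i := mul_nonneg hn.le hi
  have hdepth : ∀ g ∈ ({1}ᶜ : Finset Gal(L/K)), (0 : ℝ) ≤ (ramificationDepth π g : ℝ) - 1 :=
    fun g hg => sub_nonneg.2 <| by
      exact_mod_cast one_le_ramificationDepth hirr hπ (by simpa using hg)
  have hcont : ContinuousOn (herbrandPhi A K L) (Set.Icc 0 (n * i)) := by
    refine ContinuousOn.congr ?_ fun u hu => herbrandPhi_eq hirr hgen hπ hu.1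
    fun_prop
  have hzero : herbrandPhi A K L 0 ≤ i := by
    rwa [herbrandPhi, intervalIntegral.integral_same]
  have hle : i ≤ herbrandPhi A K L (n * i) := by
    rw [herbrandPhi_eq hirr hgen hπ hni, le_inv_mul_iff₀ hn]
    exact le_add_of_nonneg_right (Finset.sum_nonneg fun g hg => le_min hni (hdepth g hg))
  obtain ⟨u, hu, hui⟩ := intermediate_value_Icc hni hcont ⟨hzero, hle⟩
  exact ⟨u, hu.1, hui⟩

theorem card_mul_herbrandPhi_add_one_le [DecidableEq Gal(L/K)] (hirr : Irreducible π)
    (hgen : Function.Surjective (aeval π : A[X] →ₐ[A] integralClosure A L))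
    (hπ : Function.Injective fun g : Gal(L/K) => g • π) {u : ℝ} (hu : 0 ≤ u) :
    Nat.card Gal(L/K) * (herbrandPhi A K L u + 1) ≤
      u + 1 + ∑ g ∈ ({1}ᶜ : Finset Gal(L/K)), (ramificationDepth π g : ℝ) := by
  have hcard : (Nat.card Gal(L/K) : ℝ) = 1 + ∑ _g ∈ ({1}ᶜ : Finset Gal(L/K)), (1 : ℝ) := by
    rw [← Fintype.sum_eq_add_sum_compl 1 fun _ : Gal(L/K) => (1 : ℝ)]
    simp
  calc Nat.card Gal(L/K) * (herbrandPhi A K L u + 1)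
    _ = u + ∑ g ∈ ({1}ᶜ : Finset Gal(L/K)), min u ((ramificationDepth π g : ℝ) - 1) +
          Nat.card Gal(L/K) := by
        rw [herbrandPhi_eq hirr hgen hπ hu, mul_add,
          mul_inv_cancel_left₀ (Nat.cast_ne_zero.2 Nat.card_pos.ne'), mul_one]
    _ ≤ u + ∑ g ∈ ({1}ᶜ : Finset Gal(L/K)), ((ramificationDepth π g : ℝ) - 1) +
          Nat.card Gal(L/K) := by
        gcongr
        exact min_le_right _ _
    _ = u + 1 + ∑ g ∈ ({1}ᶜ : Finset Gal(L/K)), (ramificationDepth π g : ℝ) := by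
        rw [hcard, Finset.sum_sub_distrib]
        ring

theorem exists_relationsVanishModulo_of_upperGroup_ne_bot (hirr : Irreducible π)
    (hgen : Function.Surjective (aeval π : A[X] →ₐ[A] integralClosure A L))
    (hπ : Function.Injective fun g : Gal(L/K) => g • π) {i : ℝ} (hi : 0 ≤ i)
    (h : upperGroup A K L i ≠ ⊥) :
    ∃ g : Gal(L/K), g ≠ 1 ∧ ∃ (ρ : integralClosure A L) (N : ℕ),
      RelationsVanishModulo (MulSemiringAction.toAlgHom A (integralClosure A L) g) π ρ ∧
      IsDiscreteValuationRing.addVal _ ρ = N ∧ Nat.card Gal(L/K) * (i + 1) ≤ N := by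
  classical
  have hsurj := surjOn_herbrandPhi hirr hgen hπ (Set.mem_Ici.2 hi)
  have hu : 0 ≤ herbrandPsi A K L i := Function.invFunOn_mem hsurj
  have hφ : herbrandPhi A K L (herbrandPsi A K L i) = i := Function.invFunOn_eq hsurj
  obtain ⟨g₀, hg₀, hg₀1⟩ := (Subgroup.bot_or_exists_ne_one (upperGroup A K L i)).resolve_left h
  obtain ⟨g, hg, hle, ρ, hρ, hval⟩ := exists_relationsVanishModulo A hπ hg₀1
  refine ⟨g, hg, ρ, _, hρ, hval, ?_⟩
  rw [upperGroup, mem_lowerGroup_iff_le_ramificationDepth hirr hgen hπ hg₀1,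
    le_sub_iff_add_le] at hg₀
  have hle : (ramificationDepth π g₀ : ℝ) ≤ ramificationDepth π g := by exact_mod_cast hle
  have hsum := card_mul_herbrandPhi_add_one_le hirr hgen hπ hu
  rw [hφ] at hsum
  push_cast
  linarith

end Herbrand

section Generation

variable {A R : Type*} [CommRing A] [IsLocalRing A] [CommRing R] [Algebra A R]

theorem exists_sub_algebraMap_mem_maximalIdeal [IsLocalRing R] [IsLocalHom (algebraMap A R)]
    [IsAlgClosed (ResidueField A)] [Algebra.IsIntegral A R] (b : R) :
    ∃ a : A, b - algebraMap A R a ∈ maximalIdeal R := by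
  have : Algebra.IsIntegral (ResidueField A) (ResidueField R) := ⟨fun y => by
    obtain ⟨b, rfl⟩ := residue_surjective y
    exact IsIntegral.map_of_comp_eq (residue A) (residue R) rfl
      (Algebra.IsIntegral.isIntegral b)⟩
  obtain ⟨y, hy⟩ := (IsAlgClosed.algebraMap_bijective_of_isIntegral
    (k := ResidueField A) (K := ResidueField R)).2 (residue R b)
  obtain ⟨a, rfl⟩ := residue_surjective y
  refine ⟨a, ?_⟩
  rw [← residue_eq_zero_iff, map_sub, ← hy]
  exact sub_eq_zero.2 rfl

variable [IsDomain R] [IsDiscreteValuationRing R] [IsLocalHom (algebraMap A R)]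
  [IsAlgClosed (ResidueField A)] {π : R}

theorem exists_pow_dvd_sub_aeval [Algebra.IsIntegral A R] (hπ : Irreducible π) (n : ℕ) (b : R) :
    ∃ P : A[X], π ^ n ∣ b - aeval π P := by
  induction n generalizing b with
  | zero => exact ⟨0, by rw [pow_zero]; exact one_dvd _⟩
  | succ n ih =>
    obtain ⟨a, ha⟩ := exists_sub_algebraMap_mem_maximalIdeal (A := A) b
    rw [hπ.maximalIdeal_eq, Ideal.mem_span_singleton] at ha
    obtain ⟨b', hb'⟩ := ha
    obtain ⟨P, hP⟩ := ih b'
    refine ⟨C a + X * P, ?_⟩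
    have hstep : b - aeval π (C a + X * P) = π * (b' - aeval π P) := by
      simp only [map_add, aeval_C, map_mul, aeval_X]
      linear_combination hb'
    rw [hstep, pow_succ']
    exact mul_dvd_mul_left π hP

theorem surjective_aeval_of_irreducible [Module.Finite A R] (hπ : Irreducible π) {a : A}
    (ha : a ∈ maximalIdeal A) (ha0 : algebraMap A R a ≠ 0) :
    Function.Surjective (aeval π : A[X] →ₐ[A] R) := by
  obtain ⟨n, u, hu⟩ := IsDiscreteValuationRing.eq_unit_mul_pow_irreducible ha0 hπ
  have hrange : (⊤ : Submodule A R) ≤ LinearMap.range (aeval (R := A) π).toLinearMap := by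
    refine Submodule.le_of_le_smul_of_le_jacobson_bot (I := maximalIdeal A) Module.Finite.fg_top
      (maximalIdeal_le_jacobson _) fun b _ => ?_
    obtain ⟨P, r, hr⟩ := exists_pow_dvd_sub_aeval (A := A) hπ n b
    have hb : b = aeval π P + a • (((u⁻¹ : Rˣ) : R) * r) := by
      rw [Algebra.smul_def, hu]
      linear_combination hr - π ^ n * r * u.mul_inv
    rw [hb]
    exact Submodule.add_mem_sup ⟨P, rfl⟩ (Submodule.smul_mem_smul ha trivial)
  exact fun b => hrange (x := b) trivial

end Generation

section CyclotomicUnits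

theorem associated_sub_one_pow_natCast {R : Type*} [CommRing R] [IsDomain R] {p : ℕ}
    [Fact p.Prime] {n : ℕ} {ζ : R} (hζ : IsPrimitiveRoot ζ (p ^ (n + 1))) :
    Associated ((ζ - 1) ^ (p ^ n * (p - 1))) (p : R) := by
  have hp : p.Prime := Fact.out
  have : NeZero (p ^ (n + 1)) := ⟨pow_ne_zero _ hp.ne_zero⟩
  have hprod : (p : R) = ∏ ξ ∈ primitiveRoots (p ^ (n + 1)) R, (1 - ξ) := by
    simpa [eval_prod] using congrArg (eval 1) (cyclotomic_eq_prod_X_sub_primitiveRoots hζ)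
  rw [hprod, ← Nat.totient_prime_pow_succ hp, ← hζ.card_primitiveRoots, ← Finset.prod_const]
  refine Associated.prod _ _ _ fun ξ hξ => ?_
  obtain ⟨i, -, hi, rfl⟩ := hζ.isPrimitiveRoot_iff.1 (isPrimitiveRoot_of_mem_primitiveRoots hξ)
  rw [← neg_sub (ζ ^ i), Associated.neg_right_iff]
  exact hζ.associated_sub_one_pow_sub_one_of_coprime hi

theorem exists_addVal_sub_one_eq {R : Type*} [CommRing R] [IsDomain R] [IsDiscreteValuationRing R]
    {p : ℕ} [Fact p.Prime] {n e : ℕ} {ζ : R} (he : IsDiscreteValuationRing.addVal R (p : R) = e)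
    (hζ : IsPrimitiveRoot ζ (p ^ (n + 1))) :
    ∃ q : ℕ, IsDiscreteValuationRing.addVal R (ζ - 1) = q ∧ p ^ n * (p - 1) * q = e := by
  have hp : p.Prime := Fact.out
  have hζ1 : ζ - 1 ≠ 0 :=
    sub_ne_zero.2 (hζ.ne_one (Nat.one_lt_pow (Nat.succ_ne_zero n) hp.one_lt))
  have h := (IsDiscreteValuationRing.addVal_eq_iff_associated _ _).2
    (associated_sub_one_pow_natCast hζ)
  lift IsDiscreteValuationRing.addVal R (ζ - 1) to ℕ using
    (IsDiscreteValuationRing.addVal_eq_top_iff.not.2 hζ1) with q hq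
  rw [AddValuation.map_pow, ← hq, he] at h
  exact ⟨q, rfl, by rw [nsmul_eq_mul] at h; exact_mod_cast h⟩

end CyclotomicUnits

section IntegralClosure

theorem faithfulSMul_integralClosure (A K L : Type*) [CommRing A] [Field K] [Algebra A K]
    [IsFractionRing A K] [Field L] [Algebra K L] [Algebra A L] [IsScalarTower A K L] :
    FaithfulSMul A (integralClosure A L) := by
  have : FaithfulSMul A L := FaithfulSMul.trans A K L
  exact FaithfulSMul.tower_bot A (integralClosure A L) L

theorem isGaloisGroup_integralClosure (A K L : Type*) [CommRing A] [IsDomain A]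
    [IsIntegrallyClosed A] [Field K] [Algebra A K] [IsFractionRing A K] [Field L] [Algebra K L]
    [Algebra A L] [IsScalarTower A K L] [FiniteDimensional K L] [IsGalois K L] :
    IsGaloisGroup Gal(L/K) A (integralClosure A L) := by
  have : IsFractionRing (integralClosure A L) L :=
    integralClosure.isFractionRing_of_finite_extension K L
  exact IsGaloisGroup.of_isFractionRing _ _ _ K L

end IntegralClosure

section WittExtension

variable {p : ℕ} [Fact p.Prime] {k : Type*} [Field k] [CharP k p] [IsAlgClosed k]

theorem isAlgClosed_residueField_wittVector : IsAlgClosed (ResidueField (WittVector p k)) :=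
  IsAlgClosed.of_ringEquiv k _ (WittVector.quotientPEquiv.symm.trans
    (Ideal.quotEquivOfEq (WittVector.irreducible p (k := k)).maximalIdeal_eq.symm))

theorem surjective_aeval_of_irreducible_wittVector {R : Type*} [CommRing R] [IsDomain R]
    [IsDiscreteValuationRing R] [Algebra (WittVector p k) R] [FaithfulSMul (WittVector p k) R]
    [Module.Finite (WittVector p k) R] {π : R} (hπ : Irreducible π) :
    Function.Surjective (aeval π : (WittVector p k)[X] →ₐ[WittVector p k] R) := by
  have := isAlgClosed_residueField_wittVector (p := p) (k := k)
  have hirr := WittVector.irreducible p (k := k)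
  exact surjective_aeval_of_irreducible hπ ((mem_maximalIdeal _).2 hirr.not_isUnit)
    ((map_ne_zero_iff _ (FaithfulSMul.algebraMap_injective _ R)).2 hirr.ne_zero)

variable {L : Type*} [Field L] [Algebra (BaseField p k) L] [Algebra (WittVector p k) L]
  [IsScalarTower (WittVector p k) (BaseField p k) L] [FiniteDimensional (BaseField p k) L]
  [IsGalois (BaseField p k) L]

local notation "O" => integralClosure (WittVector p k) L

theorem exists_addVal_natCast_eq [IsDiscreteValuationRing O] :
    ∃ e : ℕ, IsDiscreteValuationRing.addVal O p = e ∧ 0 < e ∧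
      e ≤ Nat.card Gal(L/BaseField p k) := by
  have hirr := WittVector.irreducible p (k := k)
  have := faithfulSMul_integralClosure (WittVector p k) (BaseField p k) L
  have := isGaloisGroup_integralClosure (WittVector p k) (BaseField p k) L
  have := this.isInvariant
  have hle := addVal_algebraMap_le_card (R := O) (G := Gal(L/BaseField p k)) hirr
  have hcast : algebraMap (WittVector p k) O p = p := map_natCast _ _
  rw [hcast] at hle
  lift IsDiscreteValuationRing.addVal O (p : O) to ℕ using
    (hle.trans_lt (ENat.natCast_lt_top _)).ne with e he
  refine ⟨e, rfl, Nat.pos_of_ne_zero fun h => hirr.not_isUnit ?_, by exact_mod_cast hle⟩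
  rw [h, Nat.cast_zero, eq_comm, IsDiscreteValuationRing.addVal_eq_zero_iff, ← hcast] at he
  exact isUnit_of_map_unit _ _ he

end WittExtension

section UniformizerExpansion

variable {W R : Type*} [CommRing W] [CommRing R] [IsDomain R] [IsDiscreteValuationRing R]
  [Algebra W R] {ϖ : R}

theorem exists_uniformizer_expansion (hϖ : Irreducible ϖ)
    (hgen : Function.Surjective (aeval ϖ : W[X] →ₐ[W] R)) {α : R} (hα : α ≠ 0) {m : ℕ}
    (hm : (m : ℕ∞) ≤ IsDiscreteValuationRing.addVal R (α - 1)) :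
    ∃ (a : ℕ) (r : W) (U V : W[X]), IsUnit (aeval ϖ U) ∧ aeval ϖ (X ^ a * U) = α ∧
      X ^ a * U = C r + X ^ (a + m) * V := by
  rcases Nat.eq_zero_or_pos m with rfl | hm0
  · obtain ⟨a, ha⟩ := IsDiscreteValuationRing.associated_pow_irreducible hα hϖ
    obtain ⟨w, hw⟩ := ha.symm
    obtain ⟨U, hU⟩ := hgen w
    refine ⟨a, 0, U, U, hU ▸ w.isUnit, ?_, ?_⟩
    · rw [map_mul, map_pow, aeval_X, hU, hw]
    · rw [map_zero, zero_add, add_zero]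
  · rw [← hϖ.addVal_pow, IsDiscreteValuationRing.addVal_le_iff_dvd] at hm
    obtain ⟨s, hs⟩ := hm
    obtain ⟨V, hV⟩ := hgen s
    have hU : aeval ϖ (1 + X ^ m * V : W[X]) = α := by
      rw [map_add, map_one, map_mul, map_pow, aeval_X, hV, ← hs, add_sub_cancel]
    have hunit : IsUnit α := by
      have h := IsLocalRing.isUnit_or_isUnit_of_isUnit_add (a := α) (b := 1 - α) (by simp)
      refine h.resolve_right fun h => hϖ.not_isUnit (isUnit_of_dvd_unit ?_ h)
      rw [← dvd_neg, neg_sub, hs]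
      exact (dvd_pow_self ϖ hm0.ne').mul_right s
    refine ⟨0, 1, 1 + X ^ m * V, V, hU ▸ hunit, ?_, ?_⟩
    · rw [pow_zero, one_mul, hU]
    · rw [pow_zero, one_mul, zero_add, map_one]

end UniformizerExpansion

section NormalizedValuation

variable {R : Type*} [CommRing R] [IsDomain R] [IsDiscreteValuationRing R] {p : ℕ} {r : ℝ} {ρ : R}

/-- The valuation of `R`, rescaled so that `p` has valuation `1`, is finite and at least `r` at
`ρ`. This is the scale on which the upper numbering is measured. -/
def LeNormalizedVal (p : ℕ) (r : ℝ) (ρ : R) : Prop :=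
  ∃ e N : ℕ, 0 < e ∧ IsDiscreteValuationRing.addVal R (p : R) = e ∧
    IsDiscreteValuationRing.addVal R ρ = N ∧ e * r ≤ N

theorem mul_lt_of_mul_le {e N s : ℝ} (he : 0 < e) (hr : e * r ≤ N) (hs : s < r) : e * s < N :=
  (mul_lt_mul_of_pos_left hs he).trans_le hr

theorem not_dvd_of_addVal_lt {a b : R}
    (h : IsDiscreteValuationRing.addVal R b < IsDiscreteValuationRing.addVal R a) : ¬ a ∣ b := by
  rwa [← IsDiscreteValuationRing.addVal_le_iff_dvd, not_le]

theorem LeNormalizedVal.not_dvd_natCast_pow (h : LeNormalizedVal p r ρ) {n : ℕ} (hn : n < r) :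
    ¬ ρ ∣ (p : R) ^ n := by
  obtain ⟨e, N, he, hp, hρ, hr⟩ := h
  have hlt : e * n < N := by exact_mod_cast mul_lt_of_mul_le (Nat.cast_pos.2 he) hr hn
  refine not_dvd_of_addVal_lt ?_
  rw [AddValuation.map_pow, hp, hρ, nsmul_eq_mul, mul_comm]
  exact_mod_cast hlt

variable [Fact p.Prime]

theorem LeNormalizedVal.not_dvd_natCast_pow_mul_sub_one (h : LeNormalizedVal p r ρ) {c : ℕ}
    {ξ : R} (hξ : IsPrimitiveRoot ξ p) (hc : c + 1 / ((p : ℝ) - 1) < r) :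
    ¬ ρ ∣ (p : R) ^ c * (ξ - 1) := by
  obtain ⟨e, N, he, hp, hρ, hr⟩ := h
  obtain ⟨q, hq, hqe⟩ := exists_addVal_sub_one_eq (n := 0) hp (by simpa using hξ)
  have hp1 : (p : ℝ) - 1 ≠ 0 := sub_ne_zero.2 (Nat.cast_ne_one.2 (Fact.out : p.Prime).ne_one)
  have hqe : ((p : ℝ) - 1) * q = e := by
    rw [← hqe, pow_zero, one_mul, Nat.cast_mul, Nat.cast_pred (Fact.out : p.Prime).pos]
  have hvalue : e * (c + 1 / ((p : ℝ) - 1)) = c * e + q := by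
    rw [← hqe]
    field_simp
  have hlt : c * e + q < N := by
    exact_mod_cast hvalue ▸ mul_lt_of_mul_le (Nat.cast_pos.2 he) hr hc
  refine not_dvd_of_addVal_lt ?_
  rw [AddValuation.map_mul, AddValuation.map_pow, hp, hρ, hq, nsmul_eq_mul]
  exact_mod_cast hlt

theorem LeNormalizedVal.not_sub_one_pow_mul_dvd (h : LeNormalizedVal p r ρ) {n s m : ℕ} {ζ : R}
    (hζ : IsPrimitiveRoot ζ (p ^ (n + 1)))
    (hs : s - ((m : ℝ) - 1) / ((p : ℝ) ^ n * ((p : ℝ) - 1)) < r) :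
    ¬ (ζ - 1) ^ m * ρ ∣ (ζ - 1) * (p : R) ^ s := by
  obtain ⟨e, N, he, hp, hρ, hr⟩ := h
  obtain ⟨q, hq, hqe⟩ := exists_addVal_sub_one_eq hp hζ
  have hp0 : (p : ℝ) ≠ 0 := Nat.cast_ne_zero.2 (Fact.out : p.Prime).ne_zero
  have hp1 : (p : ℝ) - 1 ≠ 0 := sub_ne_zero.2 (Nat.cast_ne_one.2 (Fact.out : p.Prime).ne_one)
  have hqe : (p : ℝ) ^ n * ((p : ℝ) - 1) * q = e := by
    rw [← hqe, Nat.cast_mul, Nat.cast_mul, Nat.cast_pow, Nat.cast_pred (Fact.out : p.Prime).pos]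
  have hvalue : e * (s - ((m : ℝ) - 1) / ((p : ℝ) ^ n * ((p : ℝ) - 1))) =
      q + s * e - m * q := by
    rw [← hqe]
    field_simp
    ring
  have hlt : q + s * e < m * q + N := by
    exact_mod_cast sub_lt_iff_lt_add'.1 (hvalue ▸ mul_lt_of_mul_le (Nat.cast_pos.2 he) hr hs)
  refine not_dvd_of_addVal_lt ?_
  simp only [AddValuation.map_mul, AddValuation.map_pow, hp, hρ, hq, nsmul_eq_mul]
  exact_mod_cast hlt

end NormalizedValuation

section Kummer

theorem one_div_sub_one_le {p : ℝ} (hp : 2 ≤ p) (n : ℕ) :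
    1 / (p - 1) ≤ n + 1 / (p ^ n * (p - 1)) := by
  rcases Nat.eq_zero_or_pos n with rfl | hn
  · rw [pow_zero, one_mul, Nat.cast_zero, zero_add]
  · have hp1 : 1 ≤ p - 1 := by linarith
    calc 1 / (p - 1) ≤ 1 := (div_le_one (by linarith)).2 hp1
      _ ≤ n := Nat.one_le_cast.2 hn
      _ ≤ n + 1 / (p ^ n * (p - 1)) := le_add_of_nonneg_right (by positivity)

variable {W R S : Type*} [CommRing W] [CommRing R] [IsDomain R] [IsDiscreteValuationRing R]
  [Algebra W R] [CommRing S] [IsDomain S] [IsDiscreteValuationRing S] [Algebra W S]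
  {σ : R →ₐ[W] R} {π ρ : R} {p : ℕ} [Fact p.Prime] {i : ℝ}

theorem RelationsVanishModulo.map_eq_of_pow_eq_algHom (hρ : RelationsVanishModulo σ π ρ)
    (hπ : Irreducible π) (hgen : Function.Surjective (aeval π : W[X] →ₐ[W] R)) (hσπ : π ∣ σ π)
    (hi : LeNormalizedVal p (i + 1) ρ) {n c m : ℕ} {η : R} (hη : IsPrimitiveRoot η (p ^ c))
    {ζ α : S} (hζ : IsPrimitiveRoot ζ (p ^ (n + 1))) (hϖ : Irreducible (ζ - 1))
    (hgenS : Function.Surjective (aeval (ζ - 1) : W[X] →ₐ[W] S))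
    (hm : (m : ℕ∞) ≤ IsDiscreteValuationRing.addVal S (α - 1)) {f : S →ₐ[W] R}
    (hf : Function.Injective f) {x : R} (hx : x ^ p ^ c = f α) (hn : n < i)
    (hnm : (c : ℝ) + n - ((m : ℝ) - 1) / ((p : ℝ) ^ n * ((p : ℝ) - 1)) < i)
    (hnc : (c : ℝ) + n - 1 + 1 / ((p : ℝ) ^ n * ((p : ℝ) - 1)) < i) : σ x = x := by
  have hp : p.Prime := Fact.out
  rcases eq_or_ne α 0 with rfl | hα
  · rw [map_zero, pow_eq_zero_iff (pow_pos hp.pos c).ne'] at hx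
    rw [hx, map_zero]
  obtain ⟨a, r, U, V, hU, hα, hUV⟩ := exists_uniformizer_expansion hϖ hgenS hα hm
  have hfζ : IsPrimitiveRoot (f ζ) (p ^ (n + 1)) := hζ.map_of_injective hf
  have hfeval (P : W[X]) : aeval (f ζ - 1) P = f (aeval (ζ - 1) P) := by
    rw [← aeval_algHom_apply, map_sub, map_one]
  refine hρ.map_eq_of_pow_eq hπ hgen hσπ hfζ hη (hfeval U ▸ hU.map f) hUV
    (by rw [hx, hfeval, hα]) ?_ ?_ ?_
  · refine hi.not_dvd_natCast_pow ?_
    push_cast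
    linarith
  · refine hi.not_dvd_natCast_pow_mul_sub_one (hfζ.pow (pow_pos hp.pos _) (pow_succ p n)) ?_
    linarith [one_div_sub_one_le (show (2 : ℝ) ≤ p by exact_mod_cast hp.two_le) n]
  · refine hi.not_sub_one_pow_mul_dvd hfζ ?_
    push_cast
    linarith

end Kummer

section UpperNumbering

variable {p : ℕ} [Fact p.Prime] {k : Type*} [Field k] [CharP k p] [IsAlgClosed k] {L : Type*}
  [Field L] [Algebra (BaseField p k) L] [Algebra (WittVector p k) L]
  [IsScalarTower (WittVector p k) (BaseField p k) L]

local notation "W" => WittVector p k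
local notation "K₀" => BaseField p k

theorem exists_leNormalizedVal_of_upperGroup_ne_bot [FiniteDimensional K₀ L] [IsGalois K₀ L]
    [IsDiscreteValuationRing (integralClosure W L)] {π : integralClosure W L} (hπ : Irreducible π)
    (hgen : Function.Surjective (aeval π : W[X] →ₐ[W] integralClosure W L)) {i : ℝ} (hi : 0 ≤ i)
    (h : upperGroup W K₀ L i ≠ ⊥) :
    ∃ g : Gal(L/K₀), g ≠ 1 ∧ ∃ ρ : integralClosure W L,
      RelationsVanishModulo (MulSemiringAction.toAlgHom W (integralClosure W L) g) π ρ ∧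
      LeNormalizedVal p (i + 1) ρ := by
  have := (isGaloisGroup_integralClosure W K₀ L).faithful
  obtain ⟨g, hg, ρ, N, hρ, hN, hle⟩ := exists_relationsVanishModulo_of_upperGroup_ne_bot hπ hgen
    (smul_injective_of_surjective_aeval hgen) hi h
  obtain ⟨e, he, he0, hcard⟩ := exists_addVal_natCast_eq (p := p) (k := k) (L := L)
  refine ⟨g, hg, ρ, hρ, e, N, he0, he, hN, ?_⟩
  calc (e : ℝ) * (i + 1) ≤ Nat.card Gal(L/K₀) * (i + 1) := by gcongr
    _ ≤ N := hle

theorem irreducible_sub_one_of_isCyclotomicExtension {n : ℕ}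
    [IsCyclotomicExtension {p ^ (n + 1)} K₀ L] [IsDiscreteValuationRing (integralClosure W L)]
    {ζ : integralClosure W L} (hζ : IsPrimitiveRoot ζ (p ^ (n + 1))) : Irreducible (ζ - 1) := by
  have hp : p.Prime := Fact.out
  have : NeZero (p ^ (n + 1)) := ⟨pow_ne_zero _ hp.ne_zero⟩
  have := IsCyclotomicExtension.finiteDimensional {p ^ (n + 1)} K₀ L
  have := IsCyclotomicExtension.isGalois {p ^ (n + 1)} K₀ L
  obtain ⟨e, he, he0, hle⟩ := exists_addVal_natCast_eq (p := p) (k := k) (L := L)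
  obtain ⟨q, hq, rfl⟩ := exists_addVal_sub_one_eq he hζ
  have hζL : IsPrimitiveRoot (ζ : L) (p ^ (n + 1)) :=
    hζ.map_of_injective (f := algebraMap _ L) Subtype.val_injective
  have hcard : Nat.card Gal(L/K₀) ≤ p ^ n * (p - 1) := by
    refine (Nat.card_le_card_of_injective _ (hζL.autToPow_injective K₀)).trans_eq ?_
    rw [Nat.card_eq_fintype_card (α := (ZMod (p ^ (n + 1)))ˣ), ZMod.card_units_eq_totient,
      Nat.totient_prime_pow_succ hp]
  have hq1 : q = 1 := le_antisymm
    (Nat.le_of_mul_le_mul_left ((hle.trans hcard).trans_eq (mul_one _).symm)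
      (Nat.pos_of_mul_pos_right he0))
    (Nat.pos_of_mul_pos_left he0)
  obtain ⟨π, hπ⟩ := IsDiscreteValuationRing.exists_irreducible (integralClosure W L)
  refine ((IsDiscreteValuationRing.addVal_eq_iff_associated _ _).1 ?_).irreducible hπ
  rw [hq, hq1, IsDiscreteValuationRing.addVal_uniformizer hπ, Nat.cast_one]

theorem exists_isPrimitiveRoot_integralClosure {A F : Type*} [CommRing A] [Field F] [Algebra A F]
    {n : ℕ} (hn : 0 < n) {ζ : F} (hζ : IsPrimitiveRoot ζ n) :
    ∃ ζ' : integralClosure A F, (ζ' : F) = ζ ∧ IsPrimitiveRoot ζ' n :=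
  ⟨⟨ζ, (hζ.isIntegral hn).tower_top⟩, rfl,
    .of_map_of_injective (f := algebraMap (integralClosure A F) F) hζ Subtype.val_injective⟩

theorem exists_isPrimitiveRoot_sub_one_generates (n : ℕ) [IsCyclotomicExtension {p ^ (n + 1)} K₀ L]
    [IsDiscreteValuationRing (integralClosure W L)] : ∃ ζ : integralClosure W L,
    IsPrimitiveRoot ζ (p ^ (n + 1)) ∧ Irreducible (ζ - 1) ∧
      Function.Surjective (aeval (ζ - 1) : W[X] →ₐ[W] integralClosure W L) := by
  have hpos : 0 < p ^ (n + 1) := pow_pos (Fact.out : p.Prime).pos _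
  have : NeZero (p ^ (n + 1)) := ⟨hpos.ne'⟩
  have := IsCyclotomicExtension.finiteDimensional {p ^ (n + 1)} K₀ L
  have := IsIntegralClosure.finite W K₀ L (integralClosure W L)
  have := faithfulSMul_integralClosure W K₀ L
  obtain ⟨ζ, hζ⟩ :=
    IsCyclotomicExtension.exists_isPrimitiveRoot K₀ L (Set.mem_singleton (p ^ (n + 1))) hpos.ne'
  obtain ⟨ζ, -, hζ⟩ := exists_isPrimitiveRoot_integralClosure (A := W) hpos hζ
  have hϖ := irreducible_sub_one_of_isCyclotomicExtension hζ
  exact ⟨ζ, hζ, hϖ, surjective_aeval_of_irreducible_wittVector hϖ⟩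

theorem exists_fixing_roots_of_upperGroup_ne_bot [FiniteDimensional K₀ L] [IsGalois K₀ L]
    {d n c m : ℕ} (hnd : n + 1 ≤ d) (hcd : c ≤ d) {η : L} (hη : IsPrimitiveRoot η (p ^ d)) {i : ℝ}
    (h : upperGroup W K₀ L i ≠ ⊥) {M : Type*} [Field M] [Algebra K₀ M] [Algebra W M]
    [IsScalarTower W K₀ M] [IsCyclotomicExtension {p ^ (n + 1)} K₀ M]
    [IsDiscreteValuationRing (integralClosure W M)] {α : integralClosure W M}
    (hm : (m : ℕ∞) ≤ IsDiscreteValuationRing.addVal _ (α - 1)) (hid : (d : ℝ) - 1 < i)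
    (him : (c : ℝ) + n - ((m : ℝ) - 1) / ((p : ℝ) ^ n * ((p : ℝ) - 1)) < i)
    (hic : (c : ℝ) + n - 1 + 1 / ((p : ℝ) ^ n * ((p : ℝ) - 1)) < i) :
    ∃ g : Gal(L/K₀), g ≠ 1 ∧ g η = η ∧
      ∀ (j : M →ₐ[K₀] L) (y : L), y ^ p ^ c = j α → g y = y := by
  have hp : p.Prime := Fact.out
  have hn : (n : ℝ) < i := by
    have : (n : ℝ) + 1 ≤ d := by exact_mod_cast hnd
    linarith
  have := isDiscreteValuationRing_integralClosure W K₀ L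
  have := faithfulSMul_integralClosure W K₀ L
  have := IsIntegralClosure.finite W K₀ L (integralClosure W L)
  obtain ⟨π, hπ⟩ := IsDiscreteValuationRing.exists_irreducible (integralClosure W L)
  have hgen : Function.Surjective (aeval π : W[X] →ₐ[W] integralClosure W L) :=
    surjective_aeval_of_irreducible_wittVector hπ
  obtain ⟨g, hg, ρ, hρ, hi⟩ :=
    exists_leNormalizedVal_of_upperGroup_ne_bot hπ hgen (n.cast_nonneg.trans hn.le) h
  obtain ⟨η, rfl, hηO⟩ := exists_isPrimitiveRoot_integralClosure (A := W) (pow_pos hp.pos d) hη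
  refine ⟨g, hg, congrArg Subtype.val (?_ : MulSemiringAction.toAlgHom W _ g η = η),
    fun j y hy => ?_⟩
  · obtain ⟨d, rfl⟩ := Nat.exists_eq_add_of_le' (Nat.le_of_add_left_le hnd)
    refine hρ.map_eq_of_isPrimitiveRoot hgen hηO (hi.not_dvd_natCast_pow ?_)
    linarith
  · obtain ⟨ζ, hζ, hϖ, hgenM⟩ :=
      exists_isPrimitiveRoot_sub_one_generates (p := p) (k := k) (L := M) n
    let f : integralClosure W M →ₐ[W] integralClosure W L :=
      (j.restrictScalars W).mapIntegralClosure
    have hf : Function.Injective f := fun a b hab =>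
      Subtype.ext (j.injective (congrArg Subtype.val hab))
    obtain ⟨y, rfl⟩ : ∃ y' : integralClosure W L, (y' : L) = y :=
      ⟨⟨y, .of_pow (pow_pos hp.pos c) (hy ▸ (f α).2)⟩, rfl⟩
    have hηc : IsPrimitiveRoot (η ^ p ^ (d - c)) (p ^ c) :=
      hηO.pow (pow_pos hp.pos d) (by rw [← pow_add, Nat.sub_add_cancel hcd])
    exact congrArg Subtype.val (hρ.map_eq_of_pow_eq_algHom hπ hgen (dvd_smul_of_irreducible hπ g) hi
      hηc hζ hϖ hgenM hm hf (Subtype.ext hy) hn him hic)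

end UpperNumbering

section KummerClosure

variable {p : ℕ} [Fact p.Prime] {k : Type*} [Field k] [CharP k p] {n d : ℕ} {x : ClosedField p k}

local notation "K₀" => BaseField p k
local notation "Ω" => ClosedField p k

theorem exists_isPrimitiveRoot_closedField (n : ℕ) :
    ∃ ζ : ClosedField p k, IsPrimitiveRoot ζ (p ^ n) := by
  have : NeZero (p : BaseField p k) := ⟨Nat.cast_ne_zero.2 (Fact.out : p.Prime).ne_zero⟩
  exact HasEnoughRootsOfUnity.exists_primitiveRoot _ _

theorem mem_cyclotomicLayer {z : Ω} (hz : z ^ p ^ n = 1) : z ∈ cyclotomicLayer p k n :=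
  IntermediateField.subset_adjoin _ _ hz

theorem cyclotomicLayer_eq_adjoin {ζ : Ω} (hζ : IsPrimitiveRoot ζ (p ^ n)) :
    cyclotomicLayer p k n = IntermediateField.adjoin K₀ {ζ} := by
  have : NeZero (p ^ n) := ⟨pow_ne_zero n (Fact.out : p.Prime).ne_zero⟩
  refine le_antisymm (IntermediateField.adjoin_le_iff.2 fun z hz => ?_)
    (IntermediateField.adjoin_simple_le_iff.2 (mem_cyclotomicLayer hζ.pow_eq_one))
  obtain ⟨j, -, rfl⟩ := hζ.eq_pow_of_pow_eq_one hz
  exact pow_mem (IntermediateField.mem_adjoin_simple_self _ _) j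

theorem cyclotomicLayer_le_cyclotomicLayer (hnd : n ≤ d) :
    cyclotomicLayer p k n ≤ cyclotomicLayer p k d :=
  IntermediateField.adjoin.mono _ _ _ fun z hz => by
    obtain ⟨s, rfl⟩ := Nat.exists_eq_add_of_le hnd
    rw [Set.mem_ofPred_eq, pow_add, pow_mul, hz, one_pow]

instance isCyclotomicExtension_cyclotomicLayer (n : ℕ) :
    IsCyclotomicExtension {p ^ n} K₀ (cyclotomicLayer p k n) := by
  have : NeZero (p ^ n) := ⟨pow_ne_zero n (Fact.out : p.Prime).ne_zero⟩
  obtain ⟨ζ, hζ⟩ := exists_isPrimitiveRoot_closedField (p := p) (k := k) n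
  rw [cyclotomicLayer_eq_adjoin hζ]
  exact hζ.intermediateField_adjoin_isCyclotomicExtension _

instance isGalois_kummerClosure : IsGalois K₀ (kummerClosure p k d x) := by
  have : Normal K₀ (kummerClosure p k d x) := normalClosure.normal K₀ (kummerLayer p k d x) Ω
  exact ⟨⟩

theorem apply_mem_kummerClosure (σ : Gal(Ω/K₀)) {y : Ω} (hy : y ∈ kummerLayer p k d x) :
    σ y ∈ kummerClosure p k d x := by
  rw [kummerClosure, IntermediateField.normalClosure_def'']
  exact le_iSup (fun σ : Gal(Ω/K₀) => (kummerLayer p k d x).map (σ : Ω →ₐ[K₀] Ω)) σ ⟨y, hy, rfl⟩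

theorem self_mem_kummerLayer : x ∈ kummerLayer p k d x :=
  (le_sup_right : _ ≤ kummerLayer p k d x) (IntermediateField.mem_adjoin_simple_self _ x)

theorem kummerClosure_eq_adjoin {η : Ω} (hη : IsPrimitiveRoot η (p ^ d)) :
    kummerClosure p k d x =
      IntermediateField.adjoin K₀ (insert η (Set.range fun σ : Gal(Ω/K₀) => σ x)) := by
  have : NeZero (p ^ d) := ⟨pow_ne_zero d (Fact.out : p.Prime).ne_zero⟩
  refine le_antisymm ?_ (IntermediateField.adjoin_le_iff.2 (Set.insert_subset ?_ ?_))
  · rw [kummerClosure, IntermediateField.normalClosure_def'', iSup_le_iff]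
    intro σ
    rw [kummerLayer, cyclotomicLayer_eq_adjoin hη, IntermediateField.map_sup,
      IntermediateField.adjoin_map, IntermediateField.adjoin_map, Set.image_singleton,
      Set.image_singleton, sup_le_iff, IntermediateField.adjoin_simple_le_iff,
      IntermediateField.adjoin_simple_le_iff]
    refine ⟨?_, IntermediateField.subset_adjoin _ _ (.inr ⟨σ, rfl⟩)⟩
    obtain ⟨j, -, hj⟩ := hη.eq_pow_of_pow_eq_one (ξ := (σ : Ω →ₐ[K₀] Ω) η)
      (by rw [← map_pow, hη.pow_eq_one, map_one])
    exact hj ▸ pow_mem (IntermediateField.subset_adjoin _ _ (.inl rfl)) j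
  · exact apply_mem_kummerClosure 1 ((le_sup_left : _ ≤ kummerLayer p k d x)
      (mem_cyclotomicLayer hη.pow_eq_one))
  · rintro _ ⟨σ, rfl⟩
    exact apply_mem_kummerClosure σ self_mem_kummerLayer

theorem exists_algHom_kummerClosure (hnd : n ≤ d) (σ : Gal(Ω/K₀)) :
    ∃ j : cyclotomicLayer p k n →ₐ[K₀] kummerClosure p k d x,
      ∀ z : cyclotomicLayer p k n, (j z : Ω) = σ z :=
  ⟨((σ : Ω →ₐ[K₀] Ω).comp (cyclotomicLayer p k n).val).codRestrict
    (kummerClosure p k d x).toSubalgebra fun z => apply_mem_kummerClosure σ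
      ((cyclotomicLayer_le_cyclotomicLayer hnd).trans le_sup_left z.2), fun _ => rfl⟩

theorem upperGroup_kummerClosure_eq_bot [IsAlgClosed k] {c m : ℕ} (hnd : n + 1 ≤ d) (hcd : c ≤ d)
    {α : integralClosure (WittVector p k) (cyclotomicLayer p k (n + 1))}
    (hx : x ^ p ^ c = ((α : cyclotomicLayer p k (n + 1)) : Ω))
    (hm : (m : ℕ∞) ≤ val (WittVector p k) K₀ (cyclotomicLayer p k (n + 1)) (α - 1)) {i : ℝ}
    (hid : (d : ℝ) - 1 < i)
    (him : (c : ℝ) + n - ((m : ℝ) - 1) / ((p : ℝ) ^ n * ((p : ℝ) - 1)) < i)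
    (hic : (c : ℝ) + n - 1 + 1 / ((p : ℝ) ^ n * ((p : ℝ) - 1)) < i) :
    upperGroup (WittVector p k) K₀ (kummerClosure p k d x) i = ⊥ := by
  by_contra h
  have := isDiscreteValuationRing_integralClosure (WittVector p k) K₀ (cyclotomicLayer p k (n + 1))
  obtain ⟨η, hη⟩ := exists_isPrimitiveRoot_closedField (p := p) (k := k) d
  have hL := kummerClosure_eq_adjoin (x := x) hη
  obtain ⟨η, rfl⟩ : ∃ η' : kummerClosure p k d x, (η' : Ω) = η :=
    ⟨⟨η, hL ▸ IntermediateField.subset_adjoin _ _ (.inl rfl)⟩, rfl⟩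
  obtain ⟨g, hg, hgη, hgy⟩ := exists_fixing_roots_of_upperGroup_ne_bot hnd hcd
    (.of_map_of_injective (f := algebraMap _ Ω) hη Subtype.val_injective) h hm hid him hic
  refine hg (AlgEquiv.coe_toAlgHom_injective (IntermediateField.algHom_ext_of_eq_adjoin _ hL ?_))
  rintro _ (rfl | ⟨σ, rfl⟩)
  · exact hgη
  · obtain ⟨j, hj⟩ := exists_algHom_kummerClosure (x := x) hnd σ
    refine hgy j _ (Subtype.ext ?_)
    rw [hj, ← hx, map_pow]
    rfl

theorem ramConductor_kummerClosure_le [IsAlgClosed k] {l c m : ℕ} (hl : 1 ≤ l) (hd : max l c ≤ d)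
    {α : integralClosure (WittVector p k) (cyclotomicLayer p k l)}
    (hx : x ^ p ^ c = ((α : cyclotomicLayer p k l) : Ω))
    (hm : (m : ℕ∞) ≤ val (WittVector p k) K₀ (cyclotomicLayer p k l) (α - 1)) :
    ramConductor (WittVector p k) K₀ (kummerClosure p k d x) ≤
      ENNReal.ofReal (max (max ((d : ℝ) - 1)
        ((c : ℝ) + l - 1 - ((m : ℝ) - 1) / ((p : ℝ) ^ (l - 1) * ((p : ℝ) - 1))))
        ((c : ℝ) + l - 2 + 1 / ((p : ℝ) ^ (l - 1) * ((p : ℝ) - 1)))) := by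
  obtain ⟨n, rfl⟩ := Nat.exists_eq_add_of_le' hl
  refine iSup₂_le fun i hi => ENNReal.ofReal_le_ofReal ?_
  by_contra! h
  simp only [max_lt_iff, Nat.add_sub_cancel, Nat.cast_add, Nat.cast_one] at h
  obtain ⟨⟨hid, him⟩, hic⟩ := h
  exact hi.2 (upperGroup_kummerClosure_eq_bot (max_le_iff.1 hd).1 (max_le_iff.1 hd).2 hx hm hid
    (by linarith) (by linarith))

theorem exists_natCast_sub_div_le (a b : ℝ) {E : ℝ} (hE : 0 < E) :
    ∃ m : ℕ, a - ((m : ℝ) - 1) / E ≤ b := by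
  obtain ⟨m, hm⟩ := exists_nat_ge ((a - b) * E + 1)
  exact ⟨m, sub_le_comm.1 ((le_div_iff₀ hE).2 (le_sub_iff_add_le.2 hm))⟩

end KummerClosure

end LocalRamification

theorem corollary4p4 (p : ℕ) [Fact p.Prime] (k : Type*) [Field k] [CharP k p] [IsAlgClosed k]
    (l c d : ℕ) (hl : 1 ≤ l) (hc : 1 ≤ c) (hd : max l c ≤ d)
    (α t : integralClosure (WittVector p k) (LocalRamification.cyclotomicLayer p k l))
    (ht : α = 1 + t)
    (x : LocalRamification.ClosedField p k)
    (hx : x ^ p ^ c = ((α : LocalRamification.cyclotomicLayer p k l) :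
      LocalRamification.ClosedField p k)) :
    (t ≠ 0 →
      LocalRamification.ramConductor (WittVector p k) (LocalRamification.BaseField p k)
          (LocalRamification.kummerClosure p k d x) ≤
        ENNReal.ofReal (max (max ((d : ℝ) - 1)
          ((c : ℝ) + l - 1 -
            (((LocalRamification.val (WittVector p k) (LocalRamification.BaseField p k)
              (LocalRamification.cyclotomicLayer p k l) t).toNat : ℝ) - 1) /
                ((p : ℝ) ^ (l - 1) * ((p : ℝ) - 1))))
          ((c : ℝ) + l - 2 + 1 / ((p : ℝ) ^ (l - 1) * ((p : ℝ) - 1))))) ∧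
    (t = 0 →
      LocalRamification.ramConductor (WittVector p k) (LocalRamification.BaseField p k)
          (LocalRamification.kummerClosure p k d x) ≤
        ENNReal.ofReal (max ((d : ℝ) - 1)
          ((c : ℝ) + l - 2 + 1 / ((p : ℝ) ^ (l - 1) * ((p : ℝ) - 1))))) := by
  obtain rfl : t = α - 1 := by rw [ht, add_sub_cancel_left]
  refine ⟨fun _ => LocalRamification.ramConductor_kummerClosure_le hl hd hx
    (ENat.natCast_toNat_le_self _), fun ht0 => ?_⟩
  have hp : (1 : ℝ) < p := by exact_mod_cast (Fact.out : p.Prime).one_lt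
  obtain ⟨m, hm⟩ := LocalRamification.exists_natCast_sub_div_le ((c : ℝ) + l - 1) ((d : ℝ) - 1)
    (mul_pos (pow_pos (zero_lt_one.trans hp) (l - 1)) (sub_pos.2 hp))
  refine (LocalRamification.ramConductor_kummerClosure_le (m := m) hl hd hx ?_).trans_eq ?_
  · rw [ht0, AddValuation.map_zero]
    exact le_top
  · rw [max_eq_left hm]
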